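/- Let $p$ be a prime and let $\mathcal F$ be a saturated fusion system on a finite $p$-group $P$. Conventions. For $Q\le P$, $\mathcal F_Q(Q)$ is the fusion system on $Q$ whose morphisms are the maps induced by conjugation by elements of $Q$. A subgroup $Q\le P$ is strongly $\mathcal F$-closed if every $\mathcal F$-morphism whose domain lies in $Q$ has its image in $Q$; it is normal in $\mathcal F$ if $\mathcal F=N_{\mathcal F}(Q)$, that is, $Q\trianglelefteq P$ and every $\mathcal F$-morphism $R\to S$ extends to an $\mathcal F$-morphism $QR\to QS$ that maps $Q$ onto $Q$. $O_p(\mathcal F)$ is the subgroup generated by all subgroups normal in $\mathcal F$. For $R\trianglelefteq P$, $\mathcal F/R$ is the system on $P/R$ whose morphisms $A/R\to B/R$ are those induced by the $\mathcal F$-morphisms $\varphi:A\to B$ with $R\le A,B$ and $\varphi(R)=R$. A subsystem $\mathcal E$ of $\mathcal F$, on a subgroup $Q$, is normal if it is saturated, $Q$ is strongly $\mathcal F$-closed, and for all $A\le B\le Q$, $\varphi\in\mathrm{Hom}_{\mathcal E}(A,B)$ and $\psi\in\mathrm{Hom}_{\mathcal F}(B,P)$ the map $\psi(A)\to Q$,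 $\psi(x)\mapsto\psi(\varphi(x))$, is a morphism of $\mathcal E$. A subsystem is subnormal if it is joined to $\mathcal F$ by a finite chain of subsystems, each normal in the next; a minimal subnormal subsystem is one that is minimal, under inclusion, among the subnormal subsystems on non-trivial subgroups. A saturated fusion system on a non-trivial group is simple if its only normal subsystems are itself and the trivial one; it is non-abelian simple if moreover it is not of the form $\mathcal F_Q(Q)$ with $|Q|$ prime. $\mathcal F$ is $p$-soluble if there is a chain $1=P_0\le P_1\le\dots\le P_n=P$ of strongly $\mathcal F$-closed subgroups with $P_i/P_{i-1}\le O_p(\mathcal F/P_{i-1})$ for $1\le i\le n$. Statement. (a) If $\mathcal E$ is a minimal subnormal subsystem of $\mathcal F$ and $\mathcal E=\mathcal F_Q(Q)$ for a subgroup $Q\le P$ of prime order, then $Q\le O_p(\mathcal F)$. (b) $\mathcal F$ is not $p$-soluble if and only if there are a strongly $\mathcal F$-closed subgroup $R$ of $P$ and a subsystem of $\mathcal F/R$ that is a non-abelian simple fusion system. -/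

import Mathlib

universe u

namespace Fusion

variable {G : Type u} [Group G]

/-- `Rφ`: the image in `G` of `R ≤ S` under a homomorphism `φ : S → T` between subgroups of `G`. -/
def image {S T : Subgroup G} (φ : S →* T) (R : Subgroup G) : Subgroup G :=
  (R.subgroupOf S).map (T.subtype.comp φ)

/-- `φ'` extends `φ` (the codomains are compared inside `G`). -/
def Extends {R S R' S' : Subgroup G} (φ' : R' →* S') (φ : R →* S) : Prop :=
  ∃ h : R ≤ R', ∀ x : R, (φ' ⟨x, h x.2⟩ : G) = φ x

/-- A prefusion system on the subgroup `carrier` of an ambient group `G`. All systems that live on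
subgroups of one group are regarded in the same ambient group, so that a subsystem and the system
that contains it are terms of the same type. Subgroups of `carrier` are the subgroups `R` of `G`
with `R ≤ carrier`; the sets `Hom R S` are empty unless `R` and `S` are such subgroups. -/
@[ext]
structure PrefusionSystem (G : Type u) [Group G] where
  carrier : Subgroup G
  Hom : (R S : Subgroup G) → Set (R →* S)
  le_carrier : ∀ {R S : Subgroup G} {φ : R →* S}, φ ∈ Hom R S → R ≤ carrier ∧ S ≤ carrier
  injective : ∀ {R S : Subgroup G} {φ : R →* S}, φ ∈ Hom R S → Function.Injective φ

/-- A fusion system on `carrier`. Conjugation is `x ↦ x ^ g = g⁻¹ * x * g`. -/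
structure FusionSystem (G : Type u) [Group G] extends PrefusionSystem G where
  comp_mem : ∀ {R S T : Subgroup G} {φ : R →* S} {ψ : S →* T},
    φ ∈ Hom R S → ψ ∈ Hom S T → ψ.comp φ ∈ Hom R T
  conj_mem : ∀ g ∈ carrier, ∀ {R S : Subgroup G}, R ≤ carrier → S ≤ carrier → ∀ φ : R →* S,
    (∀ x : R, (φ x : G) = g⁻¹ * x * g) → φ ∈ Hom R S
  range_mem : ∀ {R S : Subgroup G} {φ : R →* S}, φ ∈ Hom R S →
    (S.subtype.comp φ).rangeRestrict ∈ Hom R (S.subtype.comp φ).range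
  symm_mem : ∀ {R S : Subgroup G} {e : R ≃* S},
    e.toMonoidHom ∈ Hom R S → e.symm.toMonoidHom ∈ Hom S R

namespace PrefusionSystem

/-- `E` is a subsystem of `F`. -/
def IsSubsystem (E F : PrefusionSystem G) : Prop :=
  E.carrier ≤ F.carrier ∧ ∀ R S : Subgroup G, E.Hom R S ⊆ F.Hom R S

/-- `N_P(Q)`, where `P` is the group on which `F` is defined. -/
def normalizerIn (F : PrefusionSystem G) (Q : Subgroup G) : Subgroup G :=
  Subgroup.normalizer (Q : Set G) ⊓ F.carrier

/-- `Q` is strongly `F`-closed. -/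
def StronglyClosed (F : PrefusionSystem G) (Q : Subgroup G) : Prop :=
  Q ≤ F.carrier ∧
    ∀ (R S : Subgroup G), R ≤ Q → ∀ φ ∈ F.Hom R S, ∀ x : R, (φ x : G) ∈ Q

/-- `Q` is fully normalized in `F`. -/
def FullyNormalized (F : PrefusionSystem G) (Q : Subgroup G) : Prop :=
  Q ≤ F.carrier ∧ ∀ (R : Subgroup G), ∀ φ ∈ F.Hom Q R, Function.Bijective φ →
    Nat.card (F.normalizerIn R) ≤ Nat.card (F.normalizerIn Q)

/-- The normalizer `N_F(Q)`, a system on `N_P(Q)`: its morphisms are the `F`-morphisms `R → S`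
that extend to an `F`-morphism `QR → QS` that restricts to an automorphism of `Q`. -/
def normalizer (F : PrefusionSystem G) (Q : Subgroup G) : PrefusionSystem G where
  carrier := F.normalizerIn Q
  Hom R S := {φ | φ ∈ F.Hom R S ∧ R ≤ F.normalizerIn Q ∧ S ≤ F.normalizerIn Q ∧
    ∃ φ' ∈ F.Hom (Q ⊔ R) (Q ⊔ S), Extends φ' φ ∧ image φ' Q = Q}
  le_carrier h := ⟨h.2.1, h.2.2.1⟩
  injective h := F.injective h.1

/-- The subgroup `Q` is normal in `F`, that is, `F = N_F(Q)`. -/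
def IsNormalSubgroup (F : PrefusionSystem G) (Q : Subgroup G) : Prop :=
  Q ≤ F.carrier ∧ F = F.normalizer Q

/-- `O_p(F)`: the join of all subgroups that are normal in `F`. -/
def Op (F : PrefusionSystem G) : Subgroup G :=
  sSup {Q | F.IsNormalSubgroup Q}

/-- The factor system `F/Q`: a morphism `R/Q → S/Q` is a homomorphism induced by some `F`-morphism
`φ : R → S`, with `Q ≤ R` and `Q ≤ S`, such that `Qφ = Q`. Subgroups of `G ⧸ Q` are represented
by their preimages in `G`. -/
def quotient (F : PrefusionSystem G) (Q : Subgroup G) [Q.Normal] : PrefusionSystem (G ⧸ Q) where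
  carrier := F.carrier.map (QuotientGroup.mk' Q)
  Hom R S := {ψ | ∃ φ ∈ F.Hom (R.comap (QuotientGroup.mk' Q)) (S.comap (QuotientGroup.mk' Q)),
    image φ Q = Q ∧
    ∀ x : R.comap (QuotientGroup.mk' Q),
      (ψ ⟨QuotientGroup.mk' Q x, x.2⟩ : G ⧸ Q) = QuotientGroup.mk' Q (φ x)}
  le_carrier := by
    rintro R S ψ ⟨φ, hφ, -, -⟩
    have hs := QuotientGroup.mk'_surjective Q
    obtain ⟨h₁, h₂⟩ := F.le_carrier hφ
    constructor
    · rw [← Subgroup.map_comap_eq_self_of_surjective hs R]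
      exact Subgroup.map_mono h₁
    · rw [← Subgroup.map_comap_eq_self_of_surjective hs S]
      exact Subgroup.map_mono h₂
  injective := by
    rintro R S ψ ⟨φ, hφ, hQ, hψ⟩
    rw [injective_iff_map_eq_one]
    rintro ⟨a, ha⟩ h
    obtain ⟨x, rfl⟩ := QuotientGroup.mk'_surjective Q a
    have h₁ := hψ ⟨x, ha⟩
    have h₂ : ((φ ⟨x, ha⟩ : S.comap (QuotientGroup.mk' Q)) : G) ∈ image φ Q := by
      rw [hQ, ← QuotientGroup.eq_one_iff]
      change QuotientGroup.mk' Q (φ ⟨x, ha⟩) = 1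
      rw [← h₁]
      exact congrArg Subtype.val h
    obtain ⟨y, hy, hyx⟩ := h₂
    have h₃ : y = ⟨x, ha⟩ := F.injective hφ (Subtype.ext hyx)
    subst h₃
    exact Subtype.ext ((QuotientGroup.eq_one_iff x).2 hy)

/-- `p`-solubility of a system `F` on the whole group `G` (`F.carrier = ⊤`): there is a chain
`1 = P₀ ≤ P₁ ≤ ⋯ ≤ Pₙ = G` of strongly `F`-closed subgroups with `Pᵢ₊₁/Pᵢ ≤ O_p(F/Pᵢ)`.
Strongly closed subgroups of a fusion system on `G` are normal in `G`, so the normality of the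
terms, which is needed to write down `G ⧸ Pᵢ`, is no restriction. -/
def IsPSoluble (F : PrefusionSystem G) : Prop :=
  ∃ (n : ℕ) (c : Fin (n + 1) → Subgroup G) (_ : ∀ i, (c i).Normal),
    c 0 = ⊥ ∧ c (Fin.last n) = ⊤ ∧ Monotone c ∧ (∀ i, F.StronglyClosed (c i)) ∧
    ∀ i : Fin n, (c i.succ).map (QuotientGroup.mk' (c i.castSucc)) ≤
      (F.quotient (c i.castSucc)).Op

end PrefusionSystem

namespace FusionSystem

/-- The group `Aut_F(Q)`. -/
def aut (F : FusionSystem G) (Q : Subgroup G) (hQ : Q ≤ F.carrier) : Subgroup (MulAut Q) where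
  carrier := {α | α.toMonoidHom ∈ F.Hom Q Q}
  mul_mem' := fun {_ _} ha hb => F.comp_mem hb ha
  one_mem' := F.conj_mem 1 F.carrier.one_mem hQ hQ _ (fun x => by simp)
  inv_mem' := fun {_} ha => F.symm_mem ha

/-- The subgroup `N_φ` of `N_P(Q)`: all `x ∈ N_P(Q)` for which there is `y ∈ N_P(Qφ)` with
`(g ^ x)φ = (gφ) ^ y` for all `g ∈ Q`. -/
def extensionDomain (F : FusionSystem G) {Q R : Subgroup G} (φ : Q →* R) : Subgroup G where
  carrier := {x | x ∈ F.normalizerIn Q ∧ ∃ y ∈ F.normalizerIn (image φ Q),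
    ∀ g h : Q, (h : G) = x⁻¹ * g * x → (φ h : G) = y⁻¹ * φ g * y}
  one_mem' := ⟨one_mem _, 1, one_mem _, fun g h e => by
    have : h = g := Subtype.ext (by simpa using e)
    simp [this]⟩
  mul_mem' := by
    rintro a b ⟨ha, y, hy, h₁⟩ ⟨hb, z, hz, h₂⟩
    refine ⟨mul_mem ha hb, y * z, mul_mem hy hz, fun g h e => ?_⟩
    have hk : a⁻¹ * g * a ∈ Q := by
      simpa using (Subgroup.mem_normalizer_iff.1 (inv_mem ha.1) g).1 g.2
    rw [h₂ ⟨_, hk⟩ h (by rw [e]; group), h₁ g ⟨_, hk⟩ rfl]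
    group
  inv_mem' := by
    rintro a ⟨ha, y, hy, h₁⟩
    refine ⟨inv_mem ha, y⁻¹, inv_mem hy, fun g h e => ?_⟩
    rw [h₁ h g (by rw [e]; group)]
    group

/-- `F` is saturated, as a system on the `p`-group `P = F.carrier`:
`Aut_P(P)` is a Sylow `p`-subgroup of `Aut_F(P)`, and every `F`-morphism `φ : Q → P` with `Qφ`
fully normalized extends to an `F`-morphism `N_φ → P`. -/
def IsSaturated (p : ℕ) (F : FusionSystem G) : Prop :=
  (∃ S : Sylow p (F.aut F.carrier le_rfl),
    (S : Subgroup (F.aut F.carrier le_rfl)) =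
      (MulAut.conj : F.carrier →* MulAut F.carrier).range.subgroupOf _) ∧
  ∀ (Q : Subgroup G), ∀ φ ∈ F.Hom Q F.carrier, F.FullyNormalized (image φ Q) →
    ∃ φ' ∈ F.Hom (F.extensionDomain φ) F.carrier, Extends φ' φ

/-- The subsystem `E` of `F`, on `Q = E.carrier`, is `F`-invariant: `Q` is strongly `F`-closed, and
for `R ≤ S ≤ Q`, `φ ∈ Hom_E(R, S)` and `ψ ∈ Hom_F(S, P)`, the map `ψ⁻¹φψ` (maps composed from left
to right), that is, `xψ ↦ xφψ` for `x ∈ R`, lies in `Hom_E(Rψ, Q)`. -/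
def IsInvariant (E F : FusionSystem G) : Prop :=
  E.toPrefusionSystem.IsSubsystem F.toPrefusionSystem ∧ F.StronglyClosed E.carrier ∧
  ∀ (R S : Subgroup G) (hRS : R ≤ S), S ≤ E.carrier →
    ∀ φ ∈ E.Hom R S, ∀ ψ ∈ F.Hom S F.carrier,
      ∃ χ ∈ E.Hom (image ψ R) E.carrier, ∀ (x : R) (y : image ψ R),
        (y : G) = ψ ⟨x, hRS x.2⟩ → (χ y : G) = ψ (φ x)

/-- `E` is a normal subsystem of `F`. -/
def IsNormalIn (p : ℕ) (E F : FusionSystem G) : Prop :=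
  E.IsInvariant F ∧ E.IsSaturated p

/-- `E` is a subnormal subsystem of `F`: there is a finite chain from `E` to `F`, each term of which
is a normal subsystem of the next one. -/
def IsSubnormalIn (p : ℕ) (E F : FusionSystem G) : Prop :=
  Relation.ReflTransGen (IsNormalIn p) E F

/-- `E` is a minimal subnormal subsystem of `F`: it is minimal, under inclusion, among the
subnormal subsystems of `F` that are not trivial. -/
def IsMinimalSubnormalIn (p : ℕ) (E F : FusionSystem G) : Prop :=
  E.IsSubnormalIn p F ∧ E.carrier ≠ ⊥ ∧
  ∀ D : FusionSystem G, D.IsSubnormalIn p F → D.carrier ≠ ⊥ →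
    D.toPrefusionSystem.IsSubsystem E.toPrefusionSystem → D = E

/-- `F` is a simple (saturated) fusion system. -/
def IsSimple (p : ℕ) (F : FusionSystem G) : Prop :=
  F.IsSaturated p ∧ F.carrier ≠ ⊥ ∧
  ∀ E : FusionSystem G, E.IsNormalIn p F → E.carrier = ⊥ ∨ E = F

/-- `F_Q(Q)`: the fusion system on `Q` whose morphisms are induced by conjugation in `Q`. -/
def ofSubgroup (Q : Subgroup G) : FusionSystem G where
  carrier := Q
  Hom R S := {φ | R ≤ Q ∧ S ≤ Q ∧ ∃ g ∈ Q, ∀ x : R, (φ x : G) = g⁻¹ * x * g}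
  le_carrier h := ⟨h.1, h.2.1⟩
  injective := by
    rintro R S φ ⟨-, -, g, -, h⟩ x y hxy
    have h₁ := congrArg (Subtype.val : S → G) hxy
    rw [h, h] at h₁
    exact Subtype.ext (by simpa using h₁)
  comp_mem := by
    rintro R S T φ ψ ⟨hR, -, g, hg, h₁⟩ ⟨-, hT, k, hk, h₂⟩
    exact ⟨hR, hT, g * k, mul_mem hg hk, fun x => by
      rw [MonoidHom.comp_apply, h₂, h₁]; group⟩
  conj_mem g hg _ _ hR hS φ h := ⟨hR, hS, g, hg, h⟩
  range_mem := by
    rintro R S φ ⟨hR, hS, g, hg, h⟩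
    refine ⟨hR, ?_, g, hg, h⟩
    rintro _ ⟨x, rfl⟩
    exact hS (φ x).2
  symm_mem := by
    rintro R S e ⟨hR, hS, g, hg, h⟩
    refine ⟨hS, hR, g⁻¹, inv_mem hg, fun x => ?_⟩
    have h₁ : ((e (e.symm x) : S) : G) = g⁻¹ * (e.symm x : R) * g := h (e.symm x)
    rw [e.apply_symm_apply] at h₁
    rw [h₁]
    change ((e.symm x : R) : G) = _
    group

/-- `F` is a non-abelian simple fusion system: it is simple, and not of the form `F_Q(Q)` with `Q`
of prime order. -/
def IsNonabelianSimple (p : ℕ) (F : FusionSystem G) : Prop :=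
  F.IsSimple p ∧ ¬ ∃ Q : Subgroup G, (Nat.card Q).Prime ∧ F = ofSubgroup Q

end FusionSystem

end Fusion

/-! Part (a) follows from the inequality $O_p(\mathcal E)\le O_p(\mathcal F)$ for subnormal
$\mathcal E$ (`IsSubnormalIn.Op_le`), because $Q$ is normal in $\mathcal F_Q(Q)$. It suffices to
take $\mathcal E$ invariant in $\mathcal F$, on $T$ say. By the Frattini property
(`IsInvariant.factors`) every $\mathcal F$-morphism inside $T$ is an $\mathcal E$-morphism followed
by an $\mathcal F$-automorphism of $T$. Both respect $O_p(\mathcal E)$ and its lower central series,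
whose terms are therefore strongly $\mathcal F$-closed. A subgroup that acts trivially on the
factors of a series of strongly closed subgroups is normal in $\mathcal F$
(`IsSaturated.isNormalSubgroup_of_series`): on a fully normalized $U$ the automorphisms stabilizing
the series form a normal $p$-subgroup of $\mathrm{Aut}_{\mathcal F}(U)$, so they lie in
$\mathrm{Aut}_P(U)$.

For (b), suppose first that $\mathcal F$ is not $p$-soluble. Take $R$ maximal among the strongly
closed subgroups reachable by a chain as in the definition. Then $O_p(\mathcal F/R)=1$, so by (a) a
minimal subnormal subsystem of $\mathcal F/R$, which is simple, is not of prime order. This needs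
that $\mathcal F/R$ is saturated (`IsSaturated.factor`) and that preimages of strongly closed
subgroups are strongly closed (`stronglyClosed_comap`). Conversely, let a chain and a non-abelian
simple subsystem of $\mathcal F/R$ be given. A simple system with a non-trivial abelian strongly
closed subgroup has prime order (`IsSimple.exists_prime`), so climbing the chain through abelian
factors shows that the preimage of the subsystem's group meets every term inside $R$. At the top the
subsystem is trivial, a contradiction.

The statements about all morphisms rest on an Alperin-type induction,
`IsSaturated.fusion_induction`. It reduces them to automorphisms of fully normalized subgroups,
which are treated by Sylow theory in $\mathrm{Aut}_{\mathcal F}(U)$. -/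

namespace Fusion

/-! ### Morphisms as functions on the ambient group -/

namespace FusionSystem

variable {G : Type u} [Group G]

/-- `F.Mor A f`: the function `f` restricts on `A` to a morphism of `F`. -/
def Mor (F : FusionSystem G) (A : Subgroup G) (f : G → G) : Prop :=
  ∃ S : Subgroup G, ∃ φ ∈ F.Hom A S, ∀ x : A, (φ x : G) = f x

/-- `F.Iso f A B`: the function `f` restricts to an isomorphism `A → B` in `F`. -/
def Iso (F : FusionSystem G) (f : G → G) (A B : Subgroup G) : Prop :=
  F.Mor A f ∧ f '' A = B

/-- The extension of a map between subgroups to a function on the ambient group. -/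
noncomputable def ext {A S : Subgroup G} (φ : A →* S) : G → G :=
  open Classical in fun x => if h : x ∈ A then (φ ⟨x, h⟩ : G) else 1

lemma ext_coe {A S : Subgroup G} (φ : A →* S) (x : A) : ext φ x = φ x := by
  simp [ext]

lemma ext_of_mem {A S : Subgroup G} (φ : A →* S) {x : G} (h : x ∈ A) : ext φ x = φ ⟨x, h⟩ := by
  simp [ext, h]

variable {F : FusionSystem G} {A B C : Subgroup G} {f g : G → G}

lemma mor_ext {S : Subgroup G} {φ : A →* S} (h : φ ∈ F.Hom A S) : F.Mor A (ext φ) :=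
  ⟨S, φ, h, fun x => (ext_coe φ x).symm⟩

namespace Mor

lemma le (h : F.Mor A f) : A ≤ F.carrier := by
  obtain ⟨S, φ, hφ, -⟩ := h
  exact (F.le_carrier hφ).1

lemma mem (h : F.Mor A f) {x : G} (hx : x ∈ A) : f x ∈ F.carrier := by
  obtain ⟨S, φ, hφ, e⟩ := h
  rw [← e ⟨x, hx⟩]
  exact (F.le_carrier hφ).2 (φ _).2

lemma map_mul (h : F.Mor A f) {x y : G} (hx : x ∈ A) (hy : y ∈ A) : f (x * y) = f x * f y := by
  obtain ⟨S, φ, hφ, e⟩ := h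
  rw [← e ⟨x, hx⟩, ← e ⟨y, hy⟩, ← e ⟨x * y, mul_mem hx hy⟩, ← Subgroup.coe_mul, ← _root_.map_mul]
  rfl

lemma map_one (h : F.Mor A f) : f 1 = 1 := by
  have := h.map_mul A.one_mem A.one_mem
  simpa using this

lemma map_inv (h : F.Mor A f) {x : G} (hx : x ∈ A) : f x⁻¹ = (f x)⁻¹ := by
  rw [eq_inv_iff_mul_eq_one, ← h.map_mul (inv_mem hx) hx, inv_mul_cancel, h.map_one]

lemma map_conj (h : F.Mor A f) {x y : G} (hx : x ∈ A) (hy : y ∈ A) :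
    f (y⁻¹ * x * y) = (f y)⁻¹ * f x * f y := by
  rw [h.map_mul (mul_mem (inv_mem hy) hx) hy, h.map_mul (inv_mem hy) hx, h.map_inv hy]

lemma inj (h : F.Mor A f) {x y : G} (hx : x ∈ A) (hy : y ∈ A) (e : f x = f y) : x = y := by
  obtain ⟨S, φ, hφ, e'⟩ := h
  have := F.injective hφ (a₁ := ⟨x, hx⟩) (a₂ := ⟨y, hy⟩) (Subtype.ext (by rw [e', e', e]))
  exact congrArg Subtype.val this

lemma congr (h : F.Mor A f) (e : ∀ x ∈ A, g x = f x) : F.Mor A g := by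
  obtain ⟨S, φ, hφ, e'⟩ := h
  exact ⟨S, φ, hφ, fun x => by rw [e', e x x.2]⟩

/-- Restrict the codomain to the range, then compose with an inclusion, which is conjugation by $1$.
Codomains therefore carry no information, and `Mor` may forget them. -/
lemma hom_mem (h : F.Mor A f) {S : Subgroup G} (hS : S ≤ F.carrier) (φ : A →* S)
    (e : ∀ x : A, (φ x : G) = f x) : φ ∈ F.Hom A S := by
  obtain ⟨S', φ', hφ', e'⟩ := h
  have h₁ := F.range_mem hφ'
  have hle : (S'.subtype.comp φ').range ≤ S := by
    rintro _ ⟨x, rfl⟩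
    change (φ' x : G) ∈ S
    rw [e', ← e]
    exact (φ x).2
  have h₂ : Subgroup.inclusion hle ∈ F.Hom _ S :=
    F.conj_mem 1 F.carrier.one_mem (hle.trans hS) hS _ (fun x => by simp)
  have h₃ := F.comp_mem h₁ h₂
  convert h₃ using 1
  ext x
  rw [e, ← e']
  rfl

/-- The homomorphism between subgroups that a morphism restricts to. -/
def hom (h : F.Mor A f) {S : Subgroup G} (hS : ∀ x ∈ A, f x ∈ S) : A →* S where
  toFun x := ⟨f x, hS x x.2⟩
  map_one' := Subtype.ext h.map_one
  map_mul' x y := Subtype.ext (h.map_mul x.2 y.2)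

lemma hom_mem_Hom (h : F.Mor A f) {S : Subgroup G} (hS : ∀ x ∈ A, f x ∈ S) (hc : S ≤ F.carrier) :
    h.hom hS ∈ F.Hom A S :=
  h.hom_mem hc _ fun _ => rfl

lemma comp (hf : F.Mor A f) (hg : F.Mor B g) (hAB : ∀ x ∈ A, f x ∈ B) : F.Mor A (g ∘ f) := by
  have h₁ := hf.hom_mem_Hom hAB hg.le
  have h₂ := hg.hom_mem_Hom (fun x hx => hg.mem hx) le_rfl
  exact ⟨_, _, F.comp_mem h₁ h₂, fun x => rfl⟩

end Mor

lemma mor_conj {k : G} (hk : k ∈ F.carrier) (hA : A ≤ F.carrier) :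
    F.Mor A (fun x => k⁻¹ * x * k) := by
  let φ : A →* F.carrier :=
    { toFun := fun x => ⟨k⁻¹ * x * k, mul_mem (mul_mem (inv_mem hk) (hA x.2)) hk⟩
      map_one' := by ext; simp
      map_mul' := fun x y => by ext; simp [mul_assoc] }
  exact ⟨_, φ, F.conj_mem k hk hA le_rfl φ (fun _ => rfl), fun _ => rfl⟩

lemma mor_id (hA : A ≤ F.carrier) : F.Mor A id :=
  (mor_conj F.carrier.one_mem hA).congr (by simp)

lemma Mor.restrict (hf : F.Mor A f) (h : B ≤ A) : F.Mor B f :=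
  (mor_id (h.trans hf.le)).comp hf h

lemma Mor.exists_iso (hf : F.Mor A f) : ∃ B, F.Iso f A B := by
  refine ⟨(hf.hom (S := F.carrier) fun x hx => hf.mem hx).range.map F.carrier.subtype, hf, ?_⟩
  ext y
  constructor
  · rintro ⟨x, hx, rfl⟩
    exact ⟨⟨f x, hf.mem hx⟩, ⟨⟨x, hx⟩, rfl⟩, rfl⟩
  · rintro ⟨_, ⟨x, rfl⟩, rfl⟩
    exact ⟨x, x.2, rfl⟩

namespace Iso

lemma mem (h : F.Iso f A B) {x : G} (hx : x ∈ A) : f x ∈ B := by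
  rw [← SetLike.mem_coe, ← h.2]
  exact ⟨x, hx, rfl⟩

lemma exists_eq (h : F.Iso f A B) {y : G} (hy : y ∈ B) : ∃ x ∈ A, f x = y := by
  rw [← SetLike.mem_coe, ← h.2] at hy
  exact hy

lemma le (h : F.Iso f A B) : B ≤ F.carrier := fun y hy => by
  obtain ⟨x, hx, rfl⟩ := h.exists_eq hy
  exact h.1.mem hx

lemma comp (h : F.Iso f A B) (h' : F.Iso g B C) : F.Iso (g ∘ f) A C :=
  ⟨h.1.comp h'.1 fun _ hx => h.mem hx, by rw [Set.image_comp, h.2, h'.2]⟩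

lemma congr (h : F.Iso f A B) (e : ∀ x ∈ A, g x = f x) : F.Iso g A B :=
  ⟨h.1.congr e, by rw [← h.2]; exact Set.image_congr e⟩

/-- The isomorphism of subgroups that an isomorphism restricts to. -/
noncomputable def equiv (h : F.Iso f A B) : A ≃* B :=
  MulEquiv.ofBijective (h.1.hom fun _ hx => h.mem hx)
    ⟨fun x y e => Subtype.ext (h.1.inj x.2 y.2 (congrArg Subtype.val e)), fun y => by
      obtain ⟨x, hx, e⟩ := h.exists_eq y.2
      exact ⟨⟨x, hx⟩, Subtype.ext e⟩⟩

@[simp] lemma equiv_apply (h : F.Iso f A B) (x : A) : (h.equiv x : G) = f x := rfl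

lemma card_eq (h : F.Iso f A B) : Nat.card A = Nat.card B := Nat.card_congr h.equiv.toEquiv

lemma exists_inv (h : F.Iso f A B) :
    ∃ g, F.Iso g B A ∧ (∀ x ∈ A, g (f x) = x) ∧ ∀ y ∈ B, f (g y) = y := by
  have h₁ : h.equiv.toMonoidHom ∈ F.Hom A B := h.1.hom_mem h.le _ fun _ => rfl
  have h₂ := F.symm_mem h₁
  have key : ∀ y (hy : y ∈ B), ext h.equiv.symm.toMonoidHom y = h.equiv.symm ⟨y, hy⟩ :=
    fun y hy => ext_of_mem _ hy
  have k₁ : ∀ x ∈ A, ext h.equiv.symm.toMonoidHom (f x) = x := fun x hx => by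
    rw [key _ (h.mem hx)]
    have : (⟨f x, h.mem hx⟩ : B) = h.equiv ⟨x, hx⟩ := rfl
    rw [this, h.equiv.symm_apply_apply]
  refine ⟨ext h.equiv.symm.toMonoidHom, ⟨mor_ext h₂, ?_⟩, k₁, fun y hy => ?_⟩
  · ext x
    constructor
    · rintro ⟨y, hy, rfl⟩
      rw [key y hy]
      exact (h.equiv.symm _).2
    · intro hx
      exact ⟨f x, h.mem hx, k₁ x hx⟩
  · rw [key y hy, ← h.equiv_apply, h.equiv.apply_symm_apply]

lemma restrict (h : F.Iso f A B) {A' : Subgroup G} (hA : A' ≤ A) : ∃ B' ≤ B, F.Iso f A' B' := by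
  obtain ⟨B', h'⟩ := (h.1.restrict hA).exists_iso
  refine ⟨B', fun y hy => ?_, h'⟩
  obtain ⟨x, hx, rfl⟩ := h'.exists_eq hy
  exact h.mem (hA hx)

end Iso

lemma Mor.iso_of_card [Finite G] (h : F.Mor A f) (hB : ∀ x ∈ A, f x ∈ B)
    (hc : Nat.card B ≤ Nat.card A) : F.Iso f A B := by
  obtain ⟨B', h'⟩ := h.exists_iso
  have hle : B' ≤ B := fun y hy => by
    obtain ⟨x, hx, rfl⟩ := h'.exists_eq hy
    exact hB x hx
  rwa [Subgroup.eq_of_le_of_card_ge hle (by rw [← h'.card_eq]; exact hc)] at h'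

lemma iso_id (hA : A ≤ F.carrier) : F.Iso id A A := ⟨mor_id hA, by simp⟩

lemma image_eq_of_iso {S : Subgroup G} {φ : A →* S} (h : F.Iso f A B)
    (e : ∀ x : A, (φ x : G) = f x) : image φ A = B := by
  ext y
  simp only [image, Subgroup.mem_map]
  constructor
  · rintro ⟨x, -, rfl⟩
    change (φ x : G) ∈ B
    rw [e]
    exact h.mem x.2
  · intro hy
    obtain ⟨x, hx, rfl⟩ := h.exists_eq hy
    exact ⟨⟨x, hx⟩, by simp, e ⟨x, hx⟩⟩

lemma mem_normalizerIn {Q : Subgroup G} {x : G} :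
    x ∈ F.normalizerIn Q ↔ (∀ y ∈ Q, x⁻¹ * y * x ∈ Q) ∧ (∀ y ∈ Q, x * y * x⁻¹ ∈ Q) ∧
      x ∈ F.carrier := by
  rw [PrefusionSystem.normalizerIn, Subgroup.mem_inf, ← and_assoc]
  refine and_congr_left' ?_
  rw [Subgroup.mem_normalizer_iff]
  constructor
  · intro h
    exact ⟨fun y hy => (h _).2 (by simpa [mul_assoc] using hy), fun y hy => (h y).1 hy⟩
  · rintro ⟨h₁, h₂⟩ y
    exact ⟨h₂ y, fun h => by simpa [mul_assoc] using h₁ _ h⟩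

lemma mem_normalizerIn_of_finite [Finite G] {Q : Subgroup G} {x : G} (hx : x ∈ F.carrier)
    (h : ∀ y ∈ Q, x⁻¹ * y * x ∈ Q) : x ∈ F.normalizerIn Q := by
  refine mem_normalizerIn.2 ⟨h, fun y hy => ?_, hx⟩
  have hs : Function.Surjective (fun y : Q => (⟨x⁻¹ * y * x, h y y.2⟩ : Q)) :=
    Finite.surjective_of_injective fun a b e => by
      have := congrArg Subtype.val e
      simpa using this
  obtain ⟨z, hz⟩ := hs ⟨y, hy⟩
  have := congrArg Subtype.val hz
  simp only at this
  rw [← this]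
  simp [mul_assoc]

lemma le_normalizerIn {Q : Subgroup G} (hQ : Q ≤ F.carrier) : Q ≤ F.normalizerIn Q :=
  le_inf Subgroup.le_normalizer hQ

lemma fullyNormalized_iff {Q : Subgroup G} : F.FullyNormalized Q ↔ Q ≤ F.carrier ∧
    ∀ f R, F.Iso f Q R → Nat.card (F.normalizerIn R) ≤ Nat.card (F.normalizerIn Q) := by
  refine and_congr_right fun hQ => ⟨fun h f R hf => ?_, fun h R φ hφ hb => ?_⟩
  · exact h R hf.equiv.toMonoidHom (hf.1.hom_mem hf.le _ fun _ => rfl) hf.equiv.bijective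
  · refine h (ext φ) R ⟨mor_ext hφ, ?_⟩
    ext y
    constructor
    · rintro ⟨x, hx, rfl⟩
      rw [ext_of_mem φ hx]
      exact (φ _).2
    · intro hy
      obtain ⟨x, hx⟩ := hb.2 ⟨y, hy⟩
      exact ⟨x, x.2, by rw [ext_coe, hx]⟩

lemma exists_fullyNormalized [Finite G] (hA : A ≤ F.carrier) :
    ∃ f U, F.Iso f A U ∧ F.FullyNormalized U := by
  let s : Set (Subgroup G) := {U | ∃ f, F.Iso f A U}
  obtain ⟨U, ⟨f, hf⟩, hU⟩ := (Set.toFinite s).exists_maximalFor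
    (fun U => Nat.card (F.normalizerIn U)) s ⟨A, id, iso_id hA⟩
  refine ⟨f, U, hf, fullyNormalized_iff.2 ⟨hf.le, fun g R hg => ?_⟩⟩
  by_contra hlt
  exact hlt (hU (j := R) ⟨_, hf.comp hg⟩ (le_of_not_ge hlt))

/-- The extension axiom, for morphisms given by functions. -/
lemma IsSaturated.exists_extension {p : ℕ} (hF : F.IsSaturated p) (hf : F.Iso f A B)
    (hB : F.FullyNormalized B) {N : Subgroup G} (hN : ∀ x ∈ N, x ∈ F.normalizerIn A ∧
      ∃ y ∈ F.normalizerIn B, ∀ a ∈ A, f (x⁻¹ * a * x) = y⁻¹ * f a * y) :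
    ∃ f', F.Mor (A ⊔ N) f' ∧ ∀ x ∈ A, f' x = f x := by
  have hc : ∀ x ∈ A, f x ∈ F.carrier := fun x hx => hf.1.mem hx
  have hi : image (hf.1.hom hc) A = B := image_eq_of_iso hf fun _ => rfl
  obtain ⟨φ', h₁, h₂⟩ := hF.2 A _ (hf.1.hom_mem_Hom hc le_rfl) (by rwa [hi])
  obtain ⟨h₂, h₃⟩ := h₂
  have hle : A ⊔ N ≤ F.extensionDomain (hf.1.hom hc) := by
    refine sup_le h₂ fun x hx => ?_
    obtain ⟨h₄, y, hy, h₅⟩ := hN x hx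
    refine ⟨h₄, y, by rwa [hi], fun g h e => ?_⟩
    change f h = y⁻¹ * f g * y
    rw [e, h₅ g g.2]
  refine ⟨_, (mor_ext h₁).restrict hle, fun x hx => ?_⟩
  rw [ext_of_mem _ (h₂ hx)]
  exact h₃ ⟨x, hx⟩

end FusionSystem

/-! ### Sylow subgroups of a subgroup -/

section Sylow

variable {M : Type u} [Group M] {p : ℕ} {H S R C : Subgroup M}

/-- `S` is a Sylow `p`-subgroup of the subgroup `H` of `M`. -/
def IsSyl (p : ℕ) (H S : Subgroup M) : Prop :=
  S ≤ H ∧ IsPGroup p S ∧ ∀ R ≤ H, IsPGroup p R → S ≤ R → R = S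

lemma isSyl_iff_exists_sylow (hle : S ≤ H) :
    IsSyl p H S ↔ ∃ T : Sylow p H, (T : Subgroup H) = S.subgroupOf H := by
  constructor
  · rintro ⟨-, hS, hm⟩
    refine ⟨⟨S.subgroupOf H, hS.of_equiv (Subgroup.subgroupOfEquivOfLe hle).symm, ?_⟩, rfl⟩
    intro Q hQ hle'
    have h₁ := hm (Q.map H.subtype) (Subgroup.map_subtype_le Q) (hQ.map _)
      (fun x hx => ⟨⟨x, hle hx⟩, hle' hx, rfl⟩)
    ext x
    rw [Subgroup.mem_subgroupOf, ← h₁]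
    simp
  · rintro ⟨T, hT⟩
    refine ⟨hle, ?_, fun R hR hp hSR => ?_⟩
    · have h₁ := T.2
      rw [hT] at h₁
      exact h₁.of_equiv (Subgroup.subgroupOfEquivOfLe hle)
    · have h₁ := T.3 (Q := R.subgroupOf H)
        (hp.of_equiv (Subgroup.subgroupOfEquivOfLe hR).symm)
        (by rw [hT]; exact fun x hx => hSR hx)
      rw [hT, Subgroup.subgroupOf_inj, inf_eq_left.2 hR, inf_eq_left.2 hle] at h₁
      exact h₁

lemma IsSyl.of_le (h : IsSyl p H S) (hSR : S ≤ R) (hRH : R ≤ H) : IsSyl p R S :=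
  ⟨hSR, h.2.1, fun Q hQ => h.2.2 Q (hQ.trans hRH)⟩

lemma IsSyl.exists_conj [Fact p.Prime] [Finite M] (hS : IsSyl p H S) (hR : R ≤ H)
    (hp : IsPGroup p R) : ∃ h ∈ H, ∀ r ∈ R, h * r * h⁻¹ ∈ S := by
  obtain ⟨T, hT⟩ := (isSyl_iff_exists_sylow hS.1).1 hS
  obtain ⟨T', hT'⟩ := (hp.of_equiv (Subgroup.subgroupOfEquivOfLe hR).symm).exists_le_sylow
  obtain ⟨h, rfl⟩ := MulAction.exists_smul_eq H T' T
  refine ⟨h, h.2, fun r hr => ?_⟩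
  have h₁ : MulAut.conj h ⟨r, hR hr⟩ ∈ ((h • T' : Sylow p H) : Subgroup H) := by
    rw [Sylow.coe_subgroup_smul]
    exact Subgroup.smul_mem_pointwise_smul _ _ _ (hT' hr)
  rw [hT] at h₁
  exact h₁

/-- A $p$-subgroup of `C` is conjugate into `S` under `H`, and normality keeps the conjugate inside
`C`; compare orders. -/
lemma IsSyl.inf_normal [Fact p.Prime] [Finite M] (hS : IsSyl p H S) (hC : C ≤ H)
    (hn : ∀ h ∈ H, ∀ c ∈ C, h * c * h⁻¹ ∈ C) : IsSyl p C (S ⊓ C) := by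
  refine ⟨inf_le_right, hS.2.1.to_le inf_le_left, fun R hR hp hle => ?_⟩
  obtain ⟨h, hh, hc⟩ := hS.exists_conj (hR.trans hC) hp
  refine (Subgroup.eq_of_le_of_card_ge hle ?_).symm
  refine Nat.card_le_card_of_injective
    (fun r : R => (⟨h * r * h⁻¹, hc r r.2, hn h hh r (hR r.2)⟩ : (S ⊓ C : Subgroup M))) ?_
  intro x y e
  have := congrArg Subtype.val e
  simpa using this

/-- The Frattini argument. -/
lemma IsSyl.frattini [Fact p.Prime] [Finite M] (hS : IsSyl p H S) (hC : C ≤ H)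
    (hn : ∀ h ∈ H, ∀ c ∈ C, h * c * h⁻¹ ∈ C) {h : M} (hh : h ∈ H) :
    ∃ c ∈ C, ∃ n ∈ H, h = c * n ∧ ∀ s ∈ S ⊓ C, n * s * n⁻¹ ∈ S ⊓ C := by
  have h₁ := hS.inf_normal hC hn
  obtain ⟨c, hc, h₂⟩ := h₁.exists_conj (R := (S ⊓ C).map (MulAut.conj h).toMonoidHom)
    (by rintro _ ⟨x, hx, rfl⟩; exact hn h hh x hx.2) (h₁.2.1.map _)
  refine ⟨c⁻¹, inv_mem hc, c * h, mul_mem (hC hc) hh, by group, fun s hs => ?_⟩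
  have h₃ := h₂ _ ⟨s, hs, rfl⟩
  convert h₃ using 1
  simp [mul_assoc]

/-- `S` is Sylow in `SC`, so some `s * c` conjugates `R` into `S`, and the factor `s` can be dropped
because it normalizes `S`. The point is that the conjugating element lies in `C`. -/
lemma IsSyl.exists_conj_of_mul [Fact p.Prime] [Finite M] (hS : IsSyl p H S) (hC : C ≤ H)
    (hn : ∀ h ∈ H, ∀ c ∈ C, h * c * h⁻¹ ∈ C) (hp : IsPGroup p R)
    (hR : ∀ r ∈ R, ∃ s ∈ S, ∃ c ∈ C, r = s * c) : ∃ c ∈ C, ∀ r ∈ R, c * r * c⁻¹ ∈ S := by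
  have hn' : ∀ h ∈ H, ∀ c ∈ C, h⁻¹ * c * h ∈ C := fun h hh c hc => by
    simpa using hn h⁻¹ (inv_mem hh) c hc
  let K : Subgroup M :=
    { carrier := {x | ∃ s ∈ S, ∃ c ∈ C, x = s * c}
      one_mem' := ⟨1, one_mem _, 1, one_mem _, by simp⟩
      mul_mem' := by
        rintro _ _ ⟨s, hs, c, hc, rfl⟩ ⟨t, ht, d, hd, rfl⟩
        exact ⟨s * t, mul_mem hs ht, t⁻¹ * c * t * d, mul_mem (hn' t (hS.1 ht) c hc) hd, by group⟩
      inv_mem' := by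
        rintro _ ⟨s, hs, c, hc, rfl⟩
        exact ⟨s⁻¹, inv_mem hs, s * c⁻¹ * s⁻¹, hn s (hS.1 hs) _ (inv_mem hc), by group⟩ }
  have hK : K ≤ H := by
    rintro _ ⟨s, hs, c, hc, rfl⟩
    exact mul_mem (hS.1 hs) (hC hc)
  have hSK : S ≤ K := fun s hs => ⟨s, hs, 1, one_mem _, by simp⟩
  obtain ⟨_, ⟨s, hs, c, hc, rfl⟩, h⟩ := (hS.of_le hSK hK).exists_conj hR hp
  refine ⟨c, hc, fun r hr => ?_⟩
  have h₁ := mul_mem (mul_mem (inv_mem hs) (h r hr)) hs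
  convert h₁ using 1
  group

lemma IsSyl.le_of_normal [Fact p.Prime] [Finite M] (hS : IsSyl p H S) (hC : C ≤ H)
    (hn : ∀ h ∈ H, ∀ c ∈ C, h * c * h⁻¹ ∈ C) (hp : IsPGroup p C) : C ≤ S := by
  obtain ⟨h, hh, h₁⟩ := hS.exists_conj hC hp
  intro c hc
  have h₂ := h₁ _ (hn h⁻¹ (inv_mem hh) c hc)
  simpa [mul_assoc] using h₂

lemma exists_normalizing_of_lt [Fact p.Prime] [Finite M] (hR : IsPGroup p R) (h : S < R) :
    ∃ x ∈ R, x ∉ S ∧ ∀ y ∈ S, x⁻¹ * y * x ∈ S := by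
  have : Group.IsNilpotent R := hR.isNilpotent
  have h₁ := Group.normalizerCondition_of_isNilpotent (G := R) (S.subgroupOf R) (lt_top_iff_ne_top.2 fun e =>
    h.not_ge (Subgroup.subgroupOf_eq_top.1 e))
  obtain ⟨x, hx, hxS⟩ := SetLike.exists_of_lt h₁
  refine ⟨x, x.2, hxS, fun y hy => ?_⟩
  rw [Subgroup.mem_normalizer_iff''] at hx
  exact (hx ⟨y, h.le hy⟩).1 hy

end Sylow

/-! ### Fully automized subgroups and induction over fully normalized subgroups -/

namespace FusionSystem

variable {G : Type u} [Group G] {F : FusionSystem G} {A B C U T : Subgroup G} {f g : G → G} {p : ℕ}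

/-- The group of automorphisms of `U` that are induced by elements of `X`. -/
def conjAut (X U : Subgroup G) : Subgroup (MulAut U) where
  carrier := {α | ∃ g ∈ X, ∀ x : U, (α x : G) = g⁻¹ * x * g}
  mul_mem' := by
    rintro α β ⟨a, ha, h⟩ ⟨b, hb, h'⟩
    refine ⟨b * a, mul_mem hb ha, fun x => ?_⟩
    rw [MulAut.mul_apply, h, h']
    group
  one_mem' := ⟨1, one_mem _, fun x => by simp⟩
  inv_mem' := by
    rintro α ⟨a, ha, h⟩
    refine ⟨a⁻¹, inv_mem ha, fun x => ?_⟩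
    have h₁ := h (α⁻¹ x)
    rw [MulAut.apply_inv_self] at h₁
    rw [h₁]
    group

/-- The group of automorphisms of `U` that are induced by elements of `N_P(U)`. -/
abbrev autCarrier (F : FusionSystem G) (U : Subgroup G) : Subgroup (MulAut U) :=
  conjAut (F.normalizerIn U) U

lemma conjAut_mono {X Y : Subgroup G} (h : X ≤ Y) (U : Subgroup G) : conjAut X U ≤ conjAut Y U := by
  rintro α ⟨x, hx, hα⟩
  exact ⟨x, h hx, hα⟩

lemma exists_mem_conjAut {X : Subgroup G} {x : G} (hx : x ∈ F.normalizerIn U) (hX : x ∈ X) :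
    ∃ α ∈ conjAut X U, ∀ u : U, (α u : G) = x⁻¹ * u * x := by
  have h := mem_normalizerIn.1 hx
  refine ⟨{ toFun := fun u => ⟨x⁻¹ * u * x, h.1 u u.2⟩
            invFun := fun u => ⟨x * u * x⁻¹, h.2.1 u u.2⟩
            left_inv := fun u => by ext; simp [mul_assoc]
            right_inv := fun u => by ext; simp [mul_assoc]
            map_mul' := fun u v => by ext; simp [mul_assoc] }, ⟨x, hX, fun u => rfl⟩, fun u => rfl⟩

lemma mem_aut_iff {hU : U ≤ F.carrier} {α : MulAut U} :
    α ∈ F.aut U hU ↔ F.Iso (ext α.toMonoidHom) U U := by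
  constructor
  · intro h
    refine ⟨mor_ext h, ?_⟩
    ext y
    constructor
    · rintro ⟨x, hx, rfl⟩
      rw [ext_of_mem _ hx]
      exact (α _).2
    · intro hy
      refine ⟨α⁻¹ ⟨y, hy⟩, (α⁻¹ _).2, ?_⟩
      rw [ext_coe]
      exact congrArg Subtype.val (MulAut.apply_inv_self _ α _)
  · intro h
    exact h.1.hom_mem hU _ fun x => (ext_coe _ x).symm

lemma mem_aut_of_forall {hU : U ≤ F.carrier} {α : MulAut U} (hf : F.Mor U f)
    (h : ∀ x : U, (α x : G) = f x) : α ∈ F.aut U hU :=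
  hf.hom_mem hU _ h

lemma exists_aut (hf : F.Iso f U U) : ∃ α ∈ F.aut U hf.le, ∀ x : U, (α x : G) = f x :=
  ⟨hf.equiv, mem_aut_of_forall hf.1 fun _ => rfl, fun _ => rfl⟩

lemma exists_iso_of_mem_aut {hU : U ≤ F.carrier} {α : MulAut U} (h : α ∈ F.aut U hU) :
    ∃ f, F.Iso f U U ∧ ∀ x : U, (α x : G) = f x :=
  ⟨_, mem_aut_iff.1 h, fun x => (ext_coe α.toMonoidHom x).symm⟩

lemma autCarrier_le (hU : U ≤ F.carrier) : F.autCarrier U ≤ F.aut U hU := by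
  rintro α ⟨x, hx, h⟩
  exact mem_aut_of_forall (mor_conj (mem_normalizerIn.1 hx).2.2 hU) h

lemma isPGroup_conjAut (hG : IsPGroup p G) (X U : Subgroup G) : IsPGroup p (conjAut X U) := by
  rintro ⟨α, x, hx, h⟩
  obtain ⟨k, hk⟩ := hG x
  refine ⟨k, Subtype.ext ?_⟩
  have key : ∀ n : ℕ, ∀ u : U, ((α ^ n) u : G) = (x ^ n)⁻¹ * u * x ^ n := by
    intro n
    induction n with
    | zero => simp
    | succ n ih =>
      intro u
      rw [pow_succ', MulAut.mul_apply, h, ih]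
      simp [pow_succ, mul_assoc]
  ext u
  simpa [hk] using key (p ^ k) u

/-- A subgroup `U` is fully automized if `Aut_P(U)` is a Sylow subgroup of `Aut_F(U)`. -/
def FullyAutomized (p : ℕ) (F : FusionSystem G) (U : Subgroup G) : Prop :=
  ∃ hU : U ≤ F.carrier, IsSyl p (F.aut U hU) (F.autCarrier U)

lemma autCarrier_carrier :
    F.autCarrier F.carrier = (MulAut.conj : F.carrier →* MulAut F.carrier).range := by
  ext α
  constructor
  · rintro ⟨x, hx, h⟩
    refine ⟨⟨x⁻¹, inv_mem (mem_normalizerIn.1 hx).2.2⟩, ?_⟩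
    ext u
    rw [h]
    simp
  · rintro ⟨x, rfl⟩
    refine ⟨x⁻¹, le_normalizerIn le_rfl (inv_mem x.2), fun u => ?_⟩
    simp

lemma isSyl_carrier_iff : IsSyl p (F.aut F.carrier le_rfl) (F.autCarrier F.carrier) ↔
    ∃ S : Sylow p (F.aut F.carrier le_rfl), (S : Subgroup (F.aut F.carrier le_rfl)) =
      (MulAut.conj : F.carrier →* MulAut F.carrier).range.subgroupOf _ := by
  rw [isSyl_iff_exists_sylow (autCarrier_le _), autCarrier_carrier]

lemma IsSaturated.fullyAutomized_carrier (hF : F.IsSaturated p) :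
    F.FullyAutomized p F.carrier :=
  ⟨le_rfl, isSyl_carrier_iff.2 hF.1⟩

variable [Finite G]

/-- Transport `R` to `U` along `f` and conjugate it into $\mathrm{Aut}_P(U)$ by Sylow's theorem; the
conjugating automorphism of `U` is absorbed into `f`. -/
lemma FullyAutomized.exists_iso [Fact p.Prime] (hU : F.FullyAutomized p U) (hf : F.Iso f A U)
    {R : Subgroup (MulAut A)} (hR : R ≤ F.aut A hf.1.le) (hp : IsPGroup p R) :
    ∃ f', F.Iso f' A U ∧ ∀ ρ ∈ R, ∃ y ∈ F.normalizerIn U, ∀ a : A,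
      f' (ρ a) = y⁻¹ * f' a * y := by
  obtain ⟨hle, hS⟩ := hU
  obtain ⟨g, hg, hgf, -⟩ := hf.exists_inv
  let e := MulAut.congr hf.equiv
  have he : ∀ ρ a, ((e ρ) (hf.equiv a) : G) = f (ρ a) := fun ρ a => by
    change (hf.equiv (ρ (hf.equiv.symm (hf.equiv a))) : G) = _
    rw [hf.equiv.symm_apply_apply]
    rfl
  obtain ⟨h, hh, hc⟩ := hS.exists_conj (R := R.map e.toMonoidHom) (by
    rintro _ ⟨ρ, hρ, rfl⟩
    obtain ⟨r, hr, hr'⟩ := exists_iso_of_mem_aut (hR hρ)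
    refine mem_aut_of_forall ((hg.comp hr).comp hf).1 fun u => ?_
    obtain ⟨a, rfl⟩ := hf.equiv.surjective u
    change ((e ρ) (hf.equiv a) : G) = _
    rw [he, hr']
    simp [hgf a a.2]) (hp.map _)
  obtain ⟨k, hk, hk'⟩ := exists_iso_of_mem_aut hh
  refine ⟨k ∘ f, hf.comp hk, fun ρ hρ => ?_⟩
  obtain ⟨y, hy, h₁⟩ := hc _ ⟨ρ, hρ, rfl⟩
  refine ⟨y, hy, fun a => ?_⟩
  have h₂ := h₁ (h (hf.equiv a))
  change ((h * e ρ * h⁻¹) (h (hf.equiv a)) : G) = _ at h₂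
  rw [MulAut.mul_apply, MulAut.inv_apply_self, MulAut.mul_apply, hk', he, hk'] at h₂
  exact h₂

/-- With $\mathrm{Aut}_P(A)$ conjugated into $\mathrm{Aut}_P(U)$, the whole of $N_P(A)$ satisfies
the condition of the extension axiom. -/
lemma FullyAutomized.exists_normalizer_extension [Fact p.Prime] (hG : IsPGroup p G)
    (hF : F.IsSaturated p) (hU : F.FullyAutomized p U) (hn : F.FullyNormalized U)
    (hf : F.Iso f A U) : ∃ θ, F.Mor (F.normalizerIn A) θ ∧ F.Iso θ A U := by
  obtain ⟨f', h₁, h₂⟩ := hU.exists_iso hf (autCarrier_le hf.1.le) (isPGroup_conjAut hG _ A)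
  obtain ⟨θ, h₃, h₄⟩ := hF.exists_extension h₁ hn (N := F.normalizerIn A) (fun x hx => by
    obtain ⟨α, hα, hx'⟩ := exists_mem_conjAut hx hx
    obtain ⟨y, hy, h₃⟩ := h₂ α hα
    refine ⟨hx, y, hy, fun a ha => ?_⟩
    rw [← h₃ ⟨a, ha⟩, hx'])
  exact ⟨θ, h₃.restrict le_sup_right, h₁.congr h₄⟩

lemma lt_normalizerIn [Fact p.Prime] (hG : IsPGroup p G) (hT : T ≤ F.carrier) (h : A < T) :
    A < F.normalizerIn A ⊓ T := by
  obtain ⟨x, hx, hxA, h₁⟩ := exists_normalizing_of_lt (hG.to_subgroup T) h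
  refine lt_of_le_of_ne (le_inf (le_normalizerIn (h.le.trans hT)) h.le) fun e => hxA ?_
  rw [e]
  exact ⟨mem_normalizerIn_of_finite (hT hx) h₁, hx⟩

lemma card_lt_card (h : A < B) : Nat.card A < Nat.card B :=
  lt_of_not_ge fun hle => h.ne (Subgroup.eq_of_le_of_card_ge h.le hle)

lemma induction_card {Q : Subgroup G → Prop}
    (h : ∀ U : Subgroup G, (∀ V : Subgroup G, Nat.card U < Nat.card V → Q V) → Q U) (U : Subgroup G) : Q U := by
  have key : ∀ n, ∀ U : Subgroup G, Nat.card G ≤ Nat.card U + n → Q U := by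
    intro n
    induction n with
    | zero =>
      refine fun U hU => h U fun V hV => absurd (Subgroup.card_le_card_group V) (by omega)
    | succ n ih => exact fun U hU => h U fun V hV => ih V (by omega)
  exact key _ U le_add_self

/-- In a saturated system fully normalized subgroups are fully automized. -/
theorem IsSaturated.fullyAutomized [Fact p.Prime] (hG : IsPGroup p G) (hF : F.IsSaturated p)
    (hU : F.FullyNormalized U) : F.FullyAutomized p U := by
  induction U using induction_card with
  | h U ih =>
  rcases hU.1.eq_or_lt with rfl | hlt
  · exact hF.fullyAutomized_carrier
  refine ⟨hU.1, ?_⟩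
  by_contra hns
  obtain ⟨R, hR, hpR, hle, hne⟩ : ∃ R ≤ F.aut U hU.1, IsPGroup p R ∧ F.autCarrier U ≤ R ∧
      R ≠ F.autCarrier U := by
    by_contra! hc
    exact hns ⟨autCarrier_le _, isPGroup_conjAut hG _ U, hc⟩
  -- Normalizers grow in the $p$-group `R`, so some element outside $\mathrm{Aut}_P(U)$ normalizes
  -- it. Its inverse `σ` then extends to an automorphism of $N_P(U)$.
  obtain ⟨τ, hτR, hτ, hτn⟩ := exists_normalizing_of_lt hpR (lt_of_le_of_ne hle hne.symm)
  obtain ⟨σ, rfl⟩ : ∃ σ, σ⁻¹ = τ := ⟨τ⁻¹, inv_inv τ⟩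
  rw [inv_mem_iff] at hτR hτ
  simp only [inv_inv] at hτn
  obtain ⟨s, hs, hσs⟩ := exists_iso_of_mem_aut (hR hτR)
  set N := F.normalizerIn U with hN
  have hUN : U < N := (lt_normalizerIn hG le_rfl hlt).trans_le inf_le_left
  obtain ⟨t, ht, hts⟩ := hF.exists_extension hs hU (N := N) (fun x hx => by
    obtain ⟨α, hα, hx'⟩ := exists_mem_conjAut hx hx
    obtain ⟨y, hy, h₃⟩ := hτn α hα
    refine ⟨hx, y, hy, fun a ha => ?_⟩
    have h₄ := h₃ (σ ⟨a, ha⟩)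
    rw [MulAut.mul_apply, MulAut.inv_apply_self, MulAut.mul_apply, hσs, hσs, hx'] at h₄
    exact h₄)
  rw [sup_eq_right.2 hUN.le] at ht
  have htN : F.Iso t N N := by
    refine ht.iso_of_card (fun x hx => mem_normalizerIn_of_finite (ht.mem hx) fun u hu => ?_) le_rfl
    obtain ⟨v, hv, rfl⟩ := hs.exists_eq hu
    have hv' := (mem_normalizerIn.1 hx).1 v hv
    rw [← hts v hv, ← ht.map_conj (hUN.le hv) hx, hts _ hv']
    exact hs.mem hv'
  obtain ⟨T, hT, hTt⟩ := exists_aut htN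
  have key : ∀ n : ℕ, ∀ u : U, ((T ^ n) ⟨u, hUN.le u.2⟩ : G) = (σ ^ n) u := by
    intro n
    induction n with
    | zero => simp
    | succ n ih =>
      intro u
      have : (T ^ n) ⟨u, hUN.le u.2⟩ = ⟨(σ ^ n) u, hUN.le ((σ ^ n) u).2⟩ := Subtype.ext (ih u)
      rw [pow_succ', pow_succ', MulAut.mul_apply, MulAut.mul_apply, this, hTt, hσs]
      exact hts _ ((σ ^ n) u).2
  obtain ⟨a, m, hm, hTo⟩ := Nat.exists_eq_pow_mul_and_not_dvd (orderOf_pos T).ne' p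
    (Fact.out : p.Prime).ne_one
  have hTm : IsPGroup p (Subgroup.zpowers (T ^ m)) := by
    refine IsPGroup.of_card_dvd_pow (n := a) ?_
    rw [Nat.card_zpowers]
    refine orderOf_dvd_of_pow_eq_one ?_
    rw [← pow_mul, mul_comm, ← hTo, pow_orderOf_eq_one]
  have hσm : σ ^ m ∉ F.autCarrier U := fun h => hτ <| by
    have h₁ : σ ∈ Subgroup.zpowers (σ ^ m) := by
      rw [mem_zpowers_pow_iff]
      obtain ⟨k, hk⟩ := hpR ⟨σ, hτR⟩
      have hd : orderOf σ ∣ p ^ k := orderOf_dvd_of_pow_eq_one (congrArg Subtype.val hk)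
      exact Nat.Coprime.coprime_dvd_right hd
        (((Nat.Prime.coprime_iff_not_dvd Fact.out).2 hm).symm.pow_right k)
    exact (Subgroup.zpowers_le.2 h) h₁
  -- A fully normalized conjugate `V` of $N_P(U)$ is fully automized by induction, so an isomorphism
  -- onto `V` can be chosen that turns `T ^ m` into conjugation by an element `y` of $P$.
  obtain ⟨r, V, hr, hV⟩ := F.exists_fullyNormalized ht.le
  obtain ⟨r', hr', hy⟩ := (ih V (by rw [← hr.card_eq]; exact card_lt_card hUN) hV).exists_iso hr
    (R := Subgroup.zpowers (T ^ m)) (Subgroup.zpowers_le.2 (pow_mem hT m)) hTm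
  obtain ⟨y, hy, h₁⟩ := hy _ (Subgroup.mem_zpowers _)
  obtain ⟨W, -, hW⟩ := hr'.restrict hUN.le
  have hyW : y ∈ F.normalizerIn W := by
    refine mem_normalizerIn_of_finite (mem_normalizerIn.1 hy).2.2 fun w hw => ?_
    obtain ⟨u, hu, rfl⟩ := hW.exists_eq hw
    rw [← h₁ ⟨u, hUN.le hu⟩, key m ⟨u, hu⟩]
    exact hW.mem ((σ ^ m) _).2
  have hVW : V ≤ F.normalizerIn W := fun v hv => by
    refine mem_normalizerIn_of_finite (hr.le hv) fun w hw => ?_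
    obtain ⟨u, hu, rfl⟩ := hW.exists_eq hw
    obtain ⟨x, hx, rfl⟩ := hr'.exists_eq hv
    rw [← hr'.1.map_conj (hUN.le hu) hx]
    exact hW.mem ((mem_normalizerIn.1 hx).1 u hu)
  -- As `U` is fully normalized, $N_P(W)$ is no larger than `V`. So `y`, which normalizes `W`, lies
  -- in `V` and comes from an element of $N_P(U)$; that element induces `σ ^ m` on `U`.
  have hVW' := Subgroup.eq_of_le_of_card_ge hVW
    (by rw [← hr.card_eq]; exact (fullyNormalized_iff.1 hU).2 _ _ hW)
  rw [← hVW'] at hyW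
  obtain ⟨z, hz, rfl⟩ := hr'.exists_eq hyW
  refine hσm ⟨z, hz, fun u => ?_⟩
  have h₂ := h₁ ⟨u, hUN.le u.2⟩
  rw [key, ← hr'.1.map_conj (hUN.le u.2) hz] at h₂
  exact hr'.1.inj (hUN.le ((σ ^ m) u).2)
    (mul_mem (mul_mem (inv_mem hz) (hUN.le u.2)) hz) h₂

end FusionSystem

lemma PrefusionSystem.StronglyClosed.mem {G : Type u} [Group G] {F : FusionSystem G}
    {A Q : Subgroup G} {f : G → G} (hQ : F.StronglyClosed Q) (hf : F.Mor A f)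
    {x : G} (hx : x ∈ A) (hxQ : x ∈ Q) : f x ∈ Q := by
  obtain ⟨S, φ, hφ, h⟩ := hf.restrict (B := A ⊓ Q) inf_le_left
  rw [← h ⟨x, hx, hxQ⟩]
  exact hQ.2 _ _ inf_le_right φ hφ _

namespace FusionSystem

variable {G : Type u} [Group G] {F : FusionSystem G} {A B C U T : Subgroup G} {f g : G → G} {p : ℕ}

lemma stronglyClosed_iff {Q : Subgroup G} : F.StronglyClosed Q ↔ Q ≤ F.carrier ∧
    ∀ A f, F.Mor A f → A ≤ Q → ∀ x ∈ A, f x ∈ Q := by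
  refine ⟨fun h => ⟨h.1, fun A f hf hA x hx => h.mem hf hx (hA hx)⟩, fun h => ⟨h.1, ?_⟩⟩
  intro R S hR φ hφ x
  rw [← ext_coe]
  exact h.2 _ _ (mor_ext hφ) hR x x.2

/-- An induction principle in the style of Alperin's fusion theorem: a property of the morphisms
between subgroups of a strongly closed subgroup `T` holds for all of them if it is compatible with
restriction, composition and inversion, holds for the automorphisms of `T`, and holds for the
automorphisms of a fully normalized subgroup whenever it holds for the morphisms that are defined
on larger subgroups. -/
theorem IsSaturated.fusion_induction [Finite G] [Fact p.Prime] (hG : IsPGroup p G)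
    (hF : F.IsSaturated p)
    (hT : F.StronglyClosed T) (Pr : Subgroup G → (G → G) → Prop)
    (restrict : ∀ A B f, B ≤ A → A ≤ T → F.Mor A f → Pr A f → Pr B f)
    (comp : ∀ A B C f g, A ≤ T → F.Iso f A B → F.Iso g B C → Pr A f → Pr B g → Pr A (g ∘ f))
    (inv : ∀ A B f g, A ≤ T → F.Iso f A B → (∀ x ∈ A, g (f x) = x) → Pr A f → Pr B g)
    (congr : ∀ A f g, (∀ x ∈ A, g x = f x) → Pr A f → Pr A g)
    (top : ∀ f, F.Mor T f → Pr T f)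
    (aut : ∀ U f, U < T → F.FullyNormalized U → F.Iso f U U →
      (∀ B f, U < B → B ≤ T → F.Mor B f → Pr B f) → Pr U f)
    (hA : A ≤ T) (hf : F.Mor A f) : Pr A f := by
  induction A using induction_card generalizing f with
  | h A ih =>
  rcases hA.eq_or_lt with rfl | hlt
  · exact top f hf
  obtain ⟨B, hB⟩ := hf.exists_iso
  have hBT : B ≤ T := fun y hy => by
    obtain ⟨x, hx, rfl⟩ := hB.exists_eq hy
    exact hT.mem hf hx (hA hx)
  have hBlt : B < T := lt_of_le_of_ne hBT fun e => by
    have := card_lt_card hlt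
    rw [hB.card_eq, e] at this
    exact this.false
  obtain ⟨h, U, hh, hU⟩ := F.exists_fullyNormalized hf.le
  have hUT : U ≤ T := fun y hy => by
    obtain ⟨x, hx, rfl⟩ := hh.exists_eq hy
    exact hT.mem hh.1 hx (hA hx)
  have hUlt : U < T := lt_of_le_of_ne hUT fun e => by
    have := card_lt_card hlt
    rw [hh.card_eq, e] at this
    exact this.false
  -- Such a `θ` is a restriction from $N_T(C)>C$, where the induction hypothesis applies. Choosing
  -- `θ : A → U` and `η : B → U` this way, `f` is $\eta^{-1}\alpha\theta$ with `α` an automorphism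
  -- of `U`.
  have key : ∀ C h, C < T → Nat.card C = Nat.card A → F.Iso h C U →
      ∃ θ, F.Iso θ C U ∧ Pr C θ := fun C h hC hc hh => by
    obtain ⟨θ, h₁, h₂⟩ := (hF.fullyAutomized hG hU).exists_normalizer_extension hG hF hU hh
    have hlt := lt_normalizerIn hG hT.1 hC
    refine ⟨θ, h₂, restrict _ _ _ hlt.le inf_le_right (h₁.restrict inf_le_left) ?_⟩
    exact ih _ (hc ▸ card_lt_card hlt) inf_le_right (h₁.restrict inf_le_left)
  obtain ⟨θ, h₁, h₂⟩ := key A h hlt rfl hh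
  obtain ⟨b, hb, hbf, hfb⟩ := hB.exists_inv
  obtain ⟨η, h₃, h₄⟩ := key B _ hBlt hB.card_eq.symm (hb.comp hh)
  obtain ⟨θ', h₅, h₆, h₇⟩ := h₁.exists_inv
  obtain ⟨η', h₈, h₉, h₁₀⟩ := h₃.exists_inv
  have hα : F.Iso (η ∘ f ∘ θ') U U := (h₅.comp hB).comp h₃
  have hα' := aut U _ hUlt hU hα fun C k hC hCT hk =>
    ih C (by rw [hh.card_eq]; exact card_lt_card hC) hCT hk
  have h₁₁ := inv _ _ _ η' hBT h₃ h₉ h₄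
  have h₁₂ := comp _ _ _ _ _ hUT hα h₈ hα' h₁₁
  refine congr _ _ _ (fun x hx => ?_) (comp _ _ _ _ _ hA h₁ (hα.comp h₈) h₂ h₁₂)
  simp [h₆ x hx, h₉ _ (hB.mem hx)]

end FusionSystem

/-! ### Extending morphisms modulo a strongly closed subgroup -/

namespace FusionSystem

variable {G : Type u} [Group G] {F : FusionSystem G} {A B C U T K O : Subgroup G} {f g : G → G}
  {p : ℕ}

lemma _root_.Fusion.PrefusionSystem.StronglyClosed.conj_mem (hK : F.StronglyClosed K) {x k : G}
    (hx : x ∈ F.carrier) (hk : k ∈ K) : x⁻¹ * k * x ∈ K :=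
  hK.mem (mor_conj hx hK.1) hk hk

lemma exists_mul_of_mem_sup (hK : F.StronglyClosed K) (hA : A ≤ F.carrier) {x : G}
    (hx : x ∈ A ⊔ K) : ∃ a ∈ A, ∃ k ∈ K, x = a * k := by
  have h : A ≤ Subgroup.normalizer (K : Set G) := fun a ha =>
    (mem_normalizerIn (F := F).2 ⟨fun y hy => hK.conj_mem (hA ha) hy, fun y hy => by
      simpa using hK.conj_mem (inv_mem (hA ha)) hy, hA ha⟩).1
  rw [← SetLike.mem_coe, Subgroup.coe_mul_of_left_le_normalizer_right _ _ h] at hx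
  obtain ⟨a, ha, k, hk, e⟩ := hx
  exact ⟨a, ha, k, hk, e.symm⟩

/-- Up to elements of `K`, the map `f` extends from `A` to `AO`. -/
def ExtendsMod (F : FusionSystem G) (O K A : Subgroup G) (f : G → G) : Prop :=
  ∃ f', F.Mor (A ⊔ O) f' ∧ ∀ x ∈ A, (f x)⁻¹ * f' x ∈ K

namespace ExtendsMod

lemma restrict (h : F.ExtendsMod O K A f) (hB : B ≤ A) : F.ExtendsMod O K B f := by
  obtain ⟨f', h₁, h₂⟩ := h
  exact ⟨f', h₁.restrict (sup_le_sup_right hB _), fun x hx => h₂ x (hB hx)⟩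

lemma congr (h : F.ExtendsMod O K A f) (e : ∀ x ∈ A, g x = f x) : F.ExtendsMod O K A g := by
  obtain ⟨f', h₁, h₂⟩ := h
  exact ⟨f', h₁, fun x hx => by rw [e x hx]; exact h₂ x hx⟩

lemma mem_sup (hO : F.StronglyClosed O) (hKO : K ≤ O) (hf : F.Iso f A B) {f' : G → G}
    (h₁ : F.Mor (A ⊔ O) f') (h₂ : ∀ x ∈ A, (f x)⁻¹ * f' x ∈ K) : ∀ x ∈ A ⊔ O, f' x ∈ B ⊔ O := by
  intro x hx
  obtain ⟨a, ha, o, ho, rfl⟩ := exists_mul_of_mem_sup hO hf.1.le hx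
  have hao : a ∈ A ⊔ O := le_sup_left (a := A) ha
  have hoo : o ∈ A ⊔ O := le_sup_right (a := A) ho
  rw [h₁.map_mul hao hoo]
  refine mul_mem ?_ (le_sup_right (a := B) (hO.mem h₁ hoo ho))
  have := mul_mem (le_sup_left (a := B) (b := O) (hf.mem ha))
    (le_sup_right (a := B) (hKO (h₂ a ha)))
  simpa using this

lemma comp (hO : F.StronglyClosed O) (hK : F.StronglyClosed K) (hKO : K ≤ O) (hf : F.Iso f A B)
    (h : F.ExtendsMod O K A f) (h' : F.ExtendsMod O K B g) :
    F.ExtendsMod O K A (g ∘ f) := by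
  obtain ⟨f', h₁, h₂⟩ := h
  obtain ⟨g', h₃, h₄⟩ := h'
  refine ⟨g' ∘ f', h₁.comp h₃ (mem_sup hO hKO hf h₁ h₂), fun x hx => ?_⟩
  have hk := h₂ x hx
  have hk' : (f x)⁻¹ * f' x ∈ B ⊔ O := le_sup_right (a := B) (hKO hk)
  have e : f' x = f x * ((f x)⁻¹ * f' x) := by group
  have e' : (g (f x))⁻¹ * g' (f' x) = (g (f x))⁻¹ * g' (f x) * g' ((f x)⁻¹ * f' x) := by
    rw [mul_assoc, ← h₃.map_mul (le_sup_left (a := B) (hf.mem hx)) hk', ← e]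
  simp only [Function.comp_apply, e']
  exact mul_mem (h₄ _ (hf.mem hx)) (hK.mem h₃ hk' hk)

lemma inv [Finite G] (hO : F.StronglyClosed O) (hK : F.StronglyClosed K) (hKO : K ≤ O)
    (hf : F.Iso f A B) (hg : ∀ x ∈ A, g (f x) = x) (h : F.ExtendsMod O K A f) :
    F.ExtendsMod O K B g := by
  obtain ⟨f', h₁, h₂⟩ := h
  have hi : F.Iso f' (A ⊔ O) (B ⊔ O) := by
    obtain ⟨C, hC⟩ := h₁.exists_iso
    have hOO : F.Iso f' O O := (h₁.restrict le_sup_right).iso_of_card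
      (fun x hx => hO.mem h₁ (le_sup_right (a := A) hx) hx) le_rfl
    have hOC : O ≤ C := fun y hy => by
      obtain ⟨x, hx, rfl⟩ := hOO.exists_eq hy
      exact hC.mem (le_sup_right (a := A) hx)
    have hBC : B ≤ C := fun y hy => by
      obtain ⟨x, hx, rfl⟩ := hf.exists_eq hy
      have := mul_mem (hC.mem (le_sup_left (a := A) hx)) (inv_mem (hOC (hKO (h₂ x hx))))
      simpa using this
    have hle : C ≤ B ⊔ O := fun y hy => by
      obtain ⟨x, hx, rfl⟩ := hC.exists_eq hy
      exact mem_sup hO hKO hf h₁ h₂ x hx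
    rwa [le_antisymm hle (sup_le hBC hOC)] at hC
  obtain ⟨g', h₃, h₄, -⟩ := hi.exists_inv
  refine ⟨g', h₃.1, fun y hy => ?_⟩
  obtain ⟨x, hx, rfl⟩ := hf.exists_eq hy
  rw [hg x hx]
  have hk := inv_mem (h₂ x hx)
  have hx' := le_sup_left (a := A) (b := O) hx
  have e : f x = f' x * ((f x)⁻¹ * f' x)⁻¹ := by group
  have hkB : ((f x)⁻¹ * f' x)⁻¹ ∈ B ⊔ O := le_sup_right (a := B) (hKO hk)
  rw [e, h₃.1.map_mul (hi.mem hx') hkB, h₄ x hx', inv_mul_cancel_left]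
  exact hK.mem h₃.1 hkB hk

end ExtendsMod

/-- The automorphisms of `U` in `F` that are trivial modulo `K`. -/
def autMod (F : FusionSystem G) (K : Subgroup G) (hU : U ≤ F.carrier) :
    Subgroup (MulAut U) where
  carrier := {α | α ∈ F.aut U hU ∧ ∀ u : U, (u : G)⁻¹ * α u ∈ K}
  one_mem' := ⟨one_mem _, fun u => by simp⟩
  mul_mem' := by
    rintro α β ⟨hα, h⟩ ⟨hβ, h'⟩
    refine ⟨mul_mem hα hβ, fun u => ?_⟩
    have := mul_mem (h' u) (h (β u))
    rw [MulAut.mul_apply]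
    simpa [mul_assoc] using this
  inv_mem' := by
    rintro α ⟨hα, h⟩
    refine ⟨inv_mem hα, fun u => ?_⟩
    have := inv_mem (h (α⁻¹ u))
    rw [MulAut.apply_inv_self] at this
    simpa using this

lemma autMod_le (hU : U ≤ F.carrier) : F.autMod K hU ≤ F.aut U hU :=
  fun _ h => h.1

lemma autMod_normal (hK : F.StronglyClosed K) (hU : U ≤ F.carrier) {h : MulAut U}
    (hh : h ∈ F.aut U hU) {c : MulAut U} (hc : c ∈ F.autMod K hU) :
    h * c * h⁻¹ ∈ F.autMod K hU := by
  refine ⟨mul_mem (mul_mem hh hc.1) (inv_mem hh), fun u => ?_⟩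
  obtain ⟨f, hf, hf'⟩ := exists_iso_of_mem_aut hh
  obtain ⟨v, rfl⟩ := h.surjective u
  rw [MulAut.mul_apply, MulAut.inv_apply_self, MulAut.mul_apply, hf', hf', ← hf.1.map_inv v.2,
    ← hf.1.map_mul (inv_mem v.2) (c v).2]
  exact hK.mem hf.1 (mul_mem (inv_mem v.2) (c v).2) (hc.2 v)

variable [Finite G]

/-- In the $p$-group `UO` some `u * o` outside `U` normalizes `U`, and then so does `o`. Hence a map
that extends only over $N_O(U)$ still acquires a strictly larger domain. -/
lemma lt_sup_normalizer [Fact p.Prime] (hG : IsPGroup p G) (hO : F.StronglyClosed O)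
    (hU : U ≤ F.carrier) (hn : ¬ O ≤ U) : U < U ⊔ F.normalizerIn U ⊓ O := by
  have hlt : U < U ⊔ O := left_lt_sup.2 hn
  obtain ⟨x, hx, hxU, h⟩ := exists_normalizing_of_lt (hG.to_subgroup _) hlt
  obtain ⟨u, hu, o, ho, rfl⟩ := exists_mul_of_mem_sup hO hU hx
  refine left_lt_sup.2 fun hle => hxU (mul_mem hu (hle ⟨?_, ho⟩))
  refine mem_normalizerIn_of_finite (hO.1 ho) fun y hy => ?_
  have := h (u * y * u⁻¹) (mul_mem (mul_mem hu hy) (inv_mem hu))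
  simpa [mul_assoc] using this

/-- Every morphism `A → P` of a saturated system agrees modulo a strongly closed subgroup `K` with
a morphism that is defined on `AK`. -/
theorem IsSaturated.extendsMod [Fact p.Prime] (hG : IsPGroup p G) (hF : F.IsSaturated p)
    (hK : F.StronglyClosed K) (hf : F.Mor A f) : F.ExtendsMod K K A f := by
  have hT : F.StronglyClosed F.carrier :=
    stronglyClosed_iff.2 ⟨le_rfl, fun A f hf _ x hx => hf.mem hx⟩
  refine hF.fusion_induction hG hT (fun A f => F.ExtendsMod K K A f)
    (fun A B f hB _ _ h => h.restrict hB) (fun A B C f g _ hf _ h h' => h.comp hK hK le_rfl hf h')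
    (fun A B f g _ hf hg h => h.inv hK hK le_rfl hf hg) (fun A f g e h => h.congr e)
    (fun f hf => ⟨f, by rwa [sup_eq_left.2 hK.1], fun x _ => by simp⟩) ?_ hf.le hf
  intro U f hUlt hU hf ih
  by_cases hKU : K ≤ U
  · exact ⟨f, by rw [sup_eq_left.2 hKU]; exact hf.1, fun x _ => by simp⟩
  obtain ⟨α, hα, hαf⟩ := exists_aut hf
  obtain ⟨hUc, hS⟩ := hF.fullyAutomized hG hU
  -- Here `c` is trivial modulo `K`, and `n` normalizes a group containing all automorphisms induced
  -- by $N_K(U)$. So `n` extends to $U N_K(U)$ and falls under the induction hypothesis, while up to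
  -- `K` the identity of `UK` extends `c`.
  obtain ⟨c, hc, n, hn, rfl, hns⟩ := hS.frattini (C := F.autMod K hUc) (autMod_le _)
    (fun h hh c hc => autMod_normal hK hUc hh hc) hα
  obtain ⟨c', hc', hcc⟩ := exists_iso_of_mem_aut hc.1
  obtain ⟨n', hn', hnn⟩ := exists_iso_of_mem_aut hn
  obtain ⟨t, ht, htn⟩ := hF.exists_extension hn' hU (N := F.normalizerIn U ⊓ K) (fun x hx => by
    obtain ⟨β, hβ, hβx⟩ := exists_mem_conjAut hx.1 hx.1
    have hβC : β ∈ F.autMod K hUc := ⟨autCarrier_le hUc hβ, fun u => by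
      rw [hβx]
      have := mul_mem (hK.conj_mem (hUc u.2) (inv_mem hx.2)) hx.2
      simpa [mul_assoc] using this⟩
    obtain ⟨⟨y, hy, h₁⟩, -⟩ := hns β ⟨hβ, hβC⟩
    refine ⟨hx.1, y, hy, fun a ha => ?_⟩
    have h₂ := h₁ (n ⟨a, ha⟩)
    rw [MulAut.mul_apply, MulAut.inv_apply_self, MulAut.mul_apply, hnn, hnn, hβx] at h₂
    exact h₂)
  have h₁ := ((ih _ t (lt_sup_normalizer hG hK hUc hKU) ht.le ht).restrict le_sup_left).congr
    fun x hx => (htn x hx).symm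
  have h₂ : F.ExtendsMod K K U c' := ⟨id, mor_id (sup_le hUc hK.1), fun x hx => by
    have := inv_mem (hc.2 ⟨x, hx⟩)
    rw [hcc] at this
    simpa using this⟩
  refine (h₁.comp hK hK le_rfl hn' h₂).congr fun x hx => ?_
  rw [← hαf ⟨x, hx⟩, MulAut.mul_apply, hcc, hnn]
  rfl

end FusionSystem

/-! ### Factor systems and their saturation -/

lemma IsSyl.of_surjective {M M' : Type u} [Group M] [Group M'] [Finite M] [Finite M'] {p : ℕ}
    [Fact p.Prime] {H S : Subgroup M} {H' S' : Subgroup M'} (h : IsSyl p H S) (hS' : S' ≤ H')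
    (π : H →* H') (hπ : Function.Surjective π)
    (hS : ∀ s : H, (s : M) ∈ S → (π s : M') ∈ S')
    (hsurj : ∀ s' ∈ S', ∃ s : H, (s : M) ∈ S ∧ (π s : M') = s') : IsSyl p H' S' := by
  obtain ⟨T, hT⟩ := (isSyl_iff_exists_sylow h.1).1 h
  refine (isSyl_iff_exists_sylow hS').2 ⟨T.mapSurjective hπ, ?_⟩
  rw [Sylow.coe_mapSurjective, hT]
  ext x
  constructor
  · rintro ⟨s, hs, rfl⟩
    exact hS s hs
  · intro hx
    obtain ⟨s, hs, e⟩ := hsurj x hx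
    exact ⟨s, hs, Subtype.ext e⟩

namespace FusionSystem

variable {G : Type u} [Group G] {F : FusionSystem G} {A B C U T K : Subgroup G} {f g : G → G}
  {p : ℕ}

/-- An injection of the finite group `K` into itself is onto. Thus the condition on the image of `K`
in the definition of a factor system is automatic. -/
lemma image_eq_self [Finite G] (hK : F.StronglyClosed K) {S : Subgroup G} {φ : A →* S}
    (hφ : φ ∈ F.Hom A S) (hKA : K ≤ A) : image φ K = K := by
  have h₁ := mor_ext hφ
  have h₂ : F.Iso (ext φ) K K := (h₁.restrict hKA).iso_of_card
    (fun x hx => hK.mem h₁ (hKA hx) hx) le_rfl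
  ext y
  constructor
  · rintro ⟨x, hx, rfl⟩
    change (φ x : G) ∈ K
    rw [← ext_coe φ x]
    exact hK.mem h₁ x.2 hx
  · intro hy
    obtain ⟨x, hx, rfl⟩ := h₂.exists_eq hy
    exact ⟨⟨x, hKA hx⟩, hx, (ext_coe φ ⟨x, hKA hx⟩).symm⟩

section Quotient

open QuotientGroup

lemma mk_eq_iff {x y : G} : (x : G ⧸ K) = y ↔ x⁻¹ * y ∈ K := QuotientGroup.eq

/-- If `f` is a morphism on `A ≥ K` and `K` is strongly closed, then `f` is compatible with
congruence modulo `K`. -/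
lemma Mor.mk_eq_mk (hK : F.StronglyClosed K) (hf : F.Mor A f) {x y : G} (hx : x ∈ A)
    (hy : y ∈ A) (e : (x : G ⧸ K) = y) : (f x : G ⧸ K) = f y := by
  rw [mk_eq_iff] at e ⊢
  rw [← hf.map_inv hx, ← hf.map_mul (inv_mem hx) hy]
  exact hK.mem hf (mul_mem (inv_mem hx) hy) e

variable [K.Normal]

lemma le_comap_mk (X : Subgroup (G ⧸ K)) : K ≤ X.comap (mk' K) := fun x hx => by
  rw [Subgroup.mem_comap, mk'_apply, (eq_one_iff x).2 hx]
  exact one_mem _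

lemma comap_map_mk (h : K ≤ A) : (A.map (mk' K)).comap (mk' K) = A := by
  rw [Subgroup.comap_map_eq, ker_mk', sup_eq_left.2 h]

lemma map_comap_mk (X : Subgroup (G ⧸ K)) : (X.comap (mk' K)).map (mk' K) = X :=
  Subgroup.map_comap_eq_self_of_surjective (mk'_surjective K) X

lemma mk_mem_map_iff (h : K ≤ A) {x : G} : (x : G ⧸ K) ∈ A.map (mk' K) ↔ x ∈ A := by
  conv_rhs => rw [← comap_map_mk h]
  rfl

lemma comap_le_carrier (hK : F.StronglyClosed K) {S : Subgroup (G ⧸ K)}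
    (hS : S ≤ F.carrier.map (mk' K)) : S.comap (mk' K) ≤ F.carrier := by
  rw [← comap_map_mk hK.1]
  exact Subgroup.comap_mono hS

variable [Finite G]

lemma mem_quotient_Hom (hK : F.StronglyClosed K) {R S : Subgroup (G ⧸ K)} {ψ : R →* S} :
    ψ ∈ (F.quotient K).Hom R S ↔ S.comap (mk' K) ≤ F.carrier ∧ ∃ f, F.Mor (R.comap (mk' K)) f ∧
      ∀ (x : G) (hx : (x : G ⧸ K) ∈ R), (ψ ⟨x, hx⟩ : G ⧸ K) = f x := by
  constructor
  · rintro ⟨φ, hφ, -, h⟩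
    refine ⟨(F.le_carrier hφ).2, ext φ, mor_ext hφ, fun x hx => ?_⟩
    exact (h ⟨x, hx⟩).trans (congrArg _ (ext_coe φ ⟨x, hx⟩).symm)
  · rintro ⟨hS, f, hf, h⟩
    have hmem : ∀ x ∈ R.comap (mk' K), f x ∈ S.comap (mk' K) := fun x hx => by
      rw [Subgroup.mem_comap, mk'_apply, ← h x hx]
      exact (ψ _).2
    exact ⟨hf.hom hmem, hf.hom_mem_Hom hmem hS,
      image_eq_self hK (hf.hom_mem_Hom hmem hS) (le_comap_mk R), fun x => h x x.2⟩

/-- The factor system `F/K` as a fusion system. -/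
def factor (F : FusionSystem G) (K : Subgroup G) [K.Normal] (hK : F.StronglyClosed K) :
    FusionSystem (G ⧸ K) where
  toPrefusionSystem := F.quotient K
  comp_mem := by
    intro R S T φ ψ hφ hψ
    obtain ⟨hS, f, hf, h⟩ := (mem_quotient_Hom hK).1 hφ
    obtain ⟨hT, g, hg, h'⟩ := (mem_quotient_Hom hK).1 hψ
    have hmem : ∀ (x : G) (hx : (x : G ⧸ K) ∈ R), (f x : G ⧸ K) ∈ S := fun x hx => by
      rw [← h x hx]; exact (φ _).2
    refine (mem_quotient_Hom hK).2 ⟨hT, g ∘ f, hf.comp hg fun x hx => hmem x hx, fun x hx => ?_⟩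
    have e : φ ⟨x, hx⟩ = ⟨f x, hmem x hx⟩ := Subtype.ext (h x hx)
    rw [MonoidHom.comp_apply, e]
    exact h' _ _
  conj_mem := by
    rintro _ ⟨k, hk, rfl⟩ R S hR hS φ h
    exact (mem_quotient_Hom hK).2 ⟨comap_le_carrier hK hS, _, mor_conj hk (comap_le_carrier hK hR),
      fun x hx => h ⟨x, hx⟩⟩
  range_mem := by
    intro R S φ hφ
    obtain ⟨hS, f, hf, h⟩ := (mem_quotient_Hom hK).1 hφ
    refine (mem_quotient_Hom hK).2 ⟨le_trans (Subgroup.comap_mono ?_) hS, f, hf, h⟩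
    rintro _ ⟨x, rfl⟩
    exact (φ x).2
  symm_mem := by
    intro R S e he
    obtain ⟨hS, f, hf, h⟩ := (mem_quotient_Hom hK).1 he
    have hRc := hf.le
    have hKK : F.Iso f K K := (hf.restrict (le_comap_mk R)).iso_of_card
      (fun x hx => hK.mem hf (le_comap_mk R hx) hx) le_rfl
    have hi : F.Iso f (R.comap (mk' K)) (S.comap (mk' K)) := by
      refine ⟨hf, ?_⟩
      ext y
      constructor
      · rintro ⟨x, hx, rfl⟩
        change (f x : G ⧸ K) ∈ S
        rw [← h x hx]
        exact (e _).2
      · intro hy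
        obtain ⟨⟨a, ha⟩, hx⟩ := e.surjective ⟨y, hy⟩
        obtain ⟨x, rfl⟩ := mk_surjective a
        have h₁ := h x ha
        change ((e ⟨x, ha⟩ : S) : G ⧸ K) = _ at h₁
        rw [hx, eq_comm, mk_eq_iff] at h₁
        obtain ⟨k, hk, hk'⟩ := hKK.exists_eq h₁
        have hkR := le_comap_mk R hk
        refine ⟨x * k, mul_mem ha hkR, ?_⟩
        rw [hf.map_mul ha hkR, hk', mul_inv_cancel_left]
    obtain ⟨g, hg, h₁, h₂⟩ := hi.exists_inv
    refine (mem_quotient_Hom hK).2 ⟨hRc, g, hg.1, fun y hy => ?_⟩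
    have h₃ := h (g y) (hg.mem hy)
    rw [h₂ y hy] at h₃
    have h₄ : (⟨y, hy⟩ : S) = e ⟨g y, hg.mem hy⟩ := Subtype.ext h₃.symm
    change ((e.symm ⟨y, hy⟩ : R) : G ⧸ K) = _
    rw [h₄, e.symm_apply_apply]

variable (hK : F.StronglyClosed K)

lemma factor_mor {R : Subgroup (G ⧸ K)} {k : G ⧸ K → G ⧸ K} (hk : (F.factor K hK).Mor R k) :
    ∃ f, F.Mor (R.comap (mk' K)) f ∧ ∀ x ∈ R.comap (mk' K), k x = f x := by
  obtain ⟨S, φ, hφ, h⟩ := hk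
  obtain ⟨hS, f, hf, h'⟩ := (mem_quotient_Hom hK).1 hφ
  exact ⟨f, hf, fun x hx => by rw [← h' x hx]; exact (h ⟨x, hx⟩).symm⟩

lemma factor_mor_of (hKA : K ≤ A) (hf : F.Mor A f) {k : G ⧸ K → G ⧸ K}
    (h : ∀ x ∈ A, k x = f x) : (F.factor K hK).Mor (A.map (mk' K)) k := by
  let φ : A.map (mk' K) →* F.carrier.map (mk' K) :=
    { toFun := fun a => ⟨k a, by
        obtain ⟨_, x, hx, rfl⟩ := a
        change k x ∈ _
        rw [h x hx]
        exact ⟨_, hf.mem hx, rfl⟩⟩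
      map_one' := Subtype.ext (by
        have := h 1 A.one_mem
        rwa [hf.map_one] at this)
      map_mul' := by
        rintro ⟨_, x, hx, rfl⟩ ⟨_, y, hy, rfl⟩
        ext
        change k ((x * y : G) : G ⧸ K) = k x * k y
        rw [h x hx, h y hy, h _ (mul_mem hx hy), hf.map_mul hx hy]
        rfl }
  refine ⟨_, φ, (mem_quotient_Hom hK).2 ⟨(comap_map_mk hK.1).le, f, ?_, ?_⟩, fun a => rfl⟩
  · rwa [comap_map_mk hKA]
  · intro x hx
    exact h x ((mk_mem_map_iff hKA).1 hx)

lemma exists_factor_mor (hKA : K ≤ A) (hf : F.Mor A f) :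
    ∃ k, (F.factor K hK).Mor (A.map (mk' K)) k ∧ ∀ x ∈ A, k x = f x := by
  have key : ∀ x ∈ A, ((f (Quotient.out (x : G ⧸ K)) : G) : G ⧸ K) = f x := fun x hx => by
    have e : ((Quotient.out (x : G ⧸ K) : G) : G ⧸ K) = x := out_eq' _
    refine hf.mk_eq_mk hK ?_ hx e
    rw [← mk_mem_map_iff hKA, e]
    exact (mk_mem_map_iff hKA).2 hx
  exact ⟨fun a => (f (Quotient.out a) : G), factor_mor_of hK hKA hf key, key⟩

lemma factor_iso_of (hKA : K ≤ A) (hf : F.Iso f A B) {k : G ⧸ K → G ⧸ K}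
    (h : ∀ x ∈ A, k x = f x) : (F.factor K hK).Iso k (A.map (mk' K)) (B.map (mk' K)) := by
  refine ⟨factor_mor_of hK hKA hf.1 h, ?_⟩
  ext y
  constructor
  · rintro ⟨_, ⟨x, hx, rfl⟩, rfl⟩
    exact ⟨f x, hf.mem hx, (h x hx).symm⟩
  · rintro ⟨y, hy, rfl⟩
    obtain ⟨x, hx, rfl⟩ := hf.exists_eq hy
    exact ⟨x, ⟨x, hx, rfl⟩, h x hx⟩

lemma factor_iso {R S : Subgroup (G ⧸ K)} {k : G ⧸ K → G ⧸ K} (hk : (F.factor K hK).Iso k R S) :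
    ∃ f, F.Iso f (R.comap (mk' K)) (S.comap (mk' K)) ∧ ∀ x ∈ R.comap (mk' K), k x = f x := by
  obtain ⟨f, hf, h⟩ := factor_mor hK hk.1
  refine ⟨f, hf.iso_of_card (fun x hx => ?_) ?_, h⟩
  · change (f x : G ⧸ K) ∈ S
    rw [← h x hx]
    exact hk.mem hx
  · have h₁ := (R.comap (mk' K)).card_mul_index
    have h₂ := (S.comap (mk' K)).card_mul_index
    rw [Subgroup.index_comap_of_surjective _ (mk'_surjective K)] at h₁ h₂
    have h₃ := R.card_mul_index
    rw [← S.card_mul_index, hk.card_eq] at h₃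
    rw [← h₁, Nat.eq_of_mul_eq_mul_left Nat.card_pos h₃] at h₂
    exact (Nat.eq_of_mul_eq_mul_right (Nat.pos_of_ne_zero Subgroup.index_ne_zero_of_finite) h₂).le

lemma mk_mem_normalizerIn_iff (hKA : K ≤ A) {x : G} :
    (x : G ⧸ K) ∈ (F.factor K hK).normalizerIn (A.map (mk' K)) ↔ x ∈ F.normalizerIn A := by
  have hc : (x : G ⧸ K) ∈ (F.factor K hK).carrier ↔ x ∈ F.carrier := mk_mem_map_iff hK.1
  constructor
  · intro h
    refine mem_normalizerIn_of_finite (hc.1 (mem_normalizerIn.1 h).2.2) fun y hy => ?_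
    exact (mk_mem_map_iff hKA).1 ((mem_normalizerIn.1 h).1 y ⟨y, hy, rfl⟩)
  · intro h
    refine mem_normalizerIn_of_finite (hc.2 (mem_normalizerIn.1 h).2.2) ?_
    rintro _ ⟨y, hy, rfl⟩
    exact ⟨_, (mem_normalizerIn.1 h).1 y hy, rfl⟩

lemma card_le_of_card_comap_le {R S : Subgroup (G ⧸ K)} (h : Nat.card R ≤ Nat.card S) :
    Nat.card (R.comap (mk' K)) ≤ Nat.card (S.comap (mk' K)) := by
  have h₁ := (R.comap (mk' K)).card_mul_index
  have h₂ := (S.comap (mk' K)).card_mul_index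
  rw [Subgroup.index_comap_of_surjective _ (mk'_surjective K)] at h₁ h₂
  have h₃ := R.card_mul_index
  rw [← S.card_mul_index] at h₃
  have h₄ : S.index ≤ R.index := by
    by_contra! hlt
    have := Nat.mul_lt_mul_of_le_of_lt h hlt Nat.card_pos
    omega
  by_contra! hlt
  have := Nat.mul_lt_mul_of_lt_of_le hlt h₄ (Nat.pos_of_ne_zero Subgroup.index_ne_zero_of_finite)
  omega

lemma comap_normalizerIn (hKA : K ≤ A) :
    ((F.factor K hK).normalizerIn (A.map (mk' K))).comap (mk' K) = F.normalizerIn A := by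
  ext x
  exact mk_mem_normalizerIn_iff hK hKA

/-- Every conjugate of `A` contains `K`, and its normalizer is the full preimage of the normalizer
of its quotient, so orders compare in the same way. -/
lemma fullyNormalized_of_factor (hKA : K ≤ A)
    (h : (F.factor K hK).FullyNormalized (A.map (mk' K))) : F.FullyNormalized A := by
  refine fullyNormalized_iff.2 ⟨?_, fun f R hf => ?_⟩
  · rw [← comap_map_mk hKA]
    exact comap_le_carrier hK h.1
  · have hKK : F.Iso f K K := (hf.1.restrict hKA).iso_of_card
      (fun x hx => hK.mem hf.1 (hKA hx) hx) le_rfl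
    have hKR : K ≤ R := fun y hy => by
      obtain ⟨x, hx, rfl⟩ := hKK.exists_eq hy
      exact hf.mem (hKA hx)
    obtain ⟨k, hk, hk'⟩ := exists_factor_mor hK hKA hf.1
    have h₁ := (fullyNormalized_iff.1 h).2 k _ (factor_iso_of hK hKA hf hk')
    rw [← comap_normalizerIn hK hKA, ← comap_normalizerIn hK hKR]
    exact card_le_of_card_comap_le h₁

/-- Reduction modulo `K` maps $\mathrm{Aut}_{\mathcal F}(A)$ onto $\mathrm{Aut}_{\mathcal F/K}(A/K)$
and $\mathrm{Aut}_P(A)$ onto $\mathrm{Aut}_{P/K}(A/K)$; surjections preserve Sylow subgroups. -/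
lemma fullyAutomized_factor [Fact p.Prime] (hKA : K ≤ A) (h : F.FullyAutomized p A) :
    (F.factor K hK).FullyAutomized p (A.map (mk' K)) := by
  obtain ⟨hA, hS⟩ := h
  have hA' : A.map (mk' K) ≤ (F.factor K hK).carrier := Subgroup.map_mono hA
  have hex : ∀ α : F.aut A hA, ∃ β : (F.factor K hK).aut _ hA', ∀ x (hx : x ∈ A),
      (β.1 ⟨x, (mk_mem_map_iff hKA).2 hx⟩ : G ⧸ K) = (α.1 ⟨x, hx⟩ : G) := fun α => by
    obtain ⟨f, hf, hf'⟩ := exists_iso_of_mem_aut α.2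
    obtain ⟨k, hk, hk'⟩ := exists_factor_mor hK hKA hf.1
    obtain ⟨β, hβ, hβ'⟩ := exists_aut (factor_iso_of hK hKA hf hk')
    exact ⟨⟨β, hβ⟩, fun x hx => by rw [hβ', hf']; exact hk' x hx⟩
  choose π hπ using hex
  have hext : ∀ β β' : (F.factor K hK).aut _ hA', (∀ x (hx : x ∈ A),
      (β.1 ⟨x, (mk_mem_map_iff hKA).2 hx⟩ : G ⧸ K) = β'.1 ⟨x, (mk_mem_map_iff hKA).2 hx⟩) →
      β = β' := fun β β' h => by
    ext ⟨a, ha⟩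
    obtain ⟨x, rfl⟩ := mk_surjective a
    exact h x ((mk_mem_map_iff hKA).1 ha)
  let Θ : F.aut A hA →* (F.factor K hK).aut _ hA' := MonoidHom.mk' π fun α β => by
    refine hext _ _ fun x hx => ?_
    have e : (π β).1 ⟨x, (mk_mem_map_iff hKA).2 hx⟩ =
      ⟨((β.1 ⟨x, hx⟩ : A) : G), (mk_mem_map_iff hKA).2 (β.1 _).2⟩ := Subtype.ext (hπ β x hx)
    rw [hπ, Subgroup.coe_mul, Subgroup.coe_mul, MulAut.mul_apply, MulAut.mul_apply, e, hπ]
  refine ⟨hA', hS.of_surjective (autCarrier_le hA') Θ (fun β => ?_) ?_ ?_⟩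
  · obtain ⟨k, hk, hk'⟩ := exists_iso_of_mem_aut β.2
    obtain ⟨f, hf, hf'⟩ := factor_iso hK hk
    rw [comap_map_mk hKA] at hf hf'
    obtain ⟨α, hα, hα'⟩ := exists_aut hf
    refine ⟨⟨α, hα⟩, hext _ _ fun x hx => ?_⟩
    change ((π ⟨α, hα⟩).1 _ : G ⧸ K) = _
    rw [hπ _ x hx, hk', hα']
    exact (hf' x hx).symm
  · rintro α ⟨x, hx, h⟩
    refine ⟨x, (mk_mem_normalizerIn_iff hK hKA).2 hx, ?_⟩
    rintro ⟨_, a, ha, rfl⟩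
    refine (hπ α a ha).trans ?_
    rw [h]
    rfl
  · rintro β ⟨a, ha, h⟩
    obtain ⟨x, rfl⟩ := mk_surjective a
    have hx := (mk_mem_normalizerIn_iff hK hKA).1 ha
    obtain ⟨α, hα, hα'⟩ := exists_mem_conjAut hx hx
    refine ⟨⟨α, autCarrier_le hA hα⟩, hα, ?_⟩
    ext ⟨b, hb⟩
    obtain ⟨y, rfl⟩ := mk_surjective b
    have hy := (mk_mem_map_iff hKA).1 hb
    refine (hπ ⟨α, _⟩ y hy).trans ?_
    rw [hα', h]
    rfl

end Quotient

lemma isSaturated_of (h : F.FullyAutomized p F.carrier)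
    (hext : ∀ f A B N, F.Iso f A B → F.FullyNormalized B → A ≤ N → (∀ x ∈ N, x ∈ F.normalizerIn A ∧
      ∃ y ∈ F.normalizerIn B, ∀ a ∈ A, f (x⁻¹ * a * x) = y⁻¹ * f a * y) →
      ∃ f', F.Mor N f' ∧ ∀ x ∈ A, f' x = f x) : F.IsSaturated p := by
  refine ⟨isSyl_carrier_iff.1 h.2, fun Q φ hφ hn => ?_⟩
  obtain ⟨B, hB⟩ := (mor_ext hφ).exists_iso
  have hi : image φ Q = B := image_eq_of_iso hB fun x => (ext_coe φ x).symm
  have hle : Q ≤ F.extensionDomain φ := fun x hx => by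
    refine ⟨le_normalizerIn hB.1.le hx, ext φ x, ?_, fun g h e => ?_⟩
    · rw [hi]
      exact le_normalizerIn hB.le (hB.mem hx)
    · rw [← ext_coe φ h, ← ext_coe φ g, e, hB.1.map_conj g.2 hx]
  obtain ⟨f', hf', h'⟩ := hext _ Q B (F.extensionDomain φ) hB (hi ▸ hn) hle (by
    rintro x ⟨hx, y, hy, h⟩
    refine ⟨hx, y, hi ▸ hy, fun a ha => ?_⟩
    have hax := (mem_normalizerIn.1 hx).1 a ha
    rw [ext_of_mem φ ha, ext_of_mem φ hax]
    exact h ⟨a, ha⟩ ⟨_, hax⟩ rfl)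
  refine ⟨hf'.hom fun x hx => hf'.mem hx, hf'.hom_mem_Hom _ le_rfl, hle, fun x => ?_⟩
  rw [← ext_coe φ x]
  exact h' x x.2

open QuotientGroup in
/-- The factor system of a saturated system by a strongly closed subgroup is saturated. -/
theorem IsSaturated.factor [Finite G] [Fact p.Prime] (hG : IsPGroup p G) (hF : F.IsSaturated p)
    [K.Normal] (hK : F.StronglyClosed K) : (F.factor K hK).IsSaturated p := by
  refine isSaturated_of (fullyAutomized_factor hK hK.1 hF.fullyAutomized_carrier) ?_
  intro k R S N hk hS hRN hN
  obtain ⟨f, hf, hfk⟩ := factor_iso hK hk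
  set A := R.comap (mk' K)
  set B := S.comap (mk' K)
  have hKA : K ≤ A := le_comap_mk R
  have hKB : K ≤ B := le_comap_mk S
  have hR' : A.map (mk' K) = R := map_comap_mk R
  have hS' : B.map (mk' K) = S := map_comap_mk S
  have hB : F.FullyNormalized B := fullyNormalized_of_factor hK hKB (by rwa [hS'])
  obtain ⟨hBc, hSyl⟩ := hF.fullyAutomized hG hB
  set X := N.comap (mk' K)
  have hX : ∀ x ∈ X, x ∈ F.normalizerIn A ∧ ∃ y ∈ F.normalizerIn B, ∀ a ∈ A,
      (y⁻¹ * f a * y)⁻¹ * f (x⁻¹ * a * x) ∈ K := fun x hx => by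
    obtain ⟨h₁, b, hb, h₂⟩ := hN x hx
    obtain ⟨y, rfl⟩ := mk_surjective b
    have hxA : x ∈ F.normalizerIn A := (mk_mem_normalizerIn_iff hK hKA).1 (by rwa [hR'])
    refine ⟨hxA, y, (mk_mem_normalizerIn_iff hK hKB).1 (by rwa [hS']), fun a ha => ?_⟩
    have h₃ := h₂ a ha
    rw [hfk a ha] at h₃
    have h₄ := hfk _ ((mem_normalizerIn.1 hxA).1 a ha)
    rw [← mk_eq_iff, ← h₄]
    exact h₃.symm
  have hXA : X ≤ F.normalizerIn A := fun x hx => (hX x hx).1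
  let e := MulAut.congr hf.equiv
  have he : ∀ ρ a, ((e ρ) (hf.equiv a) : G) = f (ρ a) := fun ρ a => by
    change (hf.equiv (ρ (hf.equiv.symm (hf.equiv a))) : G) = _
    rw [hf.equiv.symm_apply_apply]
    rfl
  obtain ⟨g, hg, hgf, -⟩ := hf.exists_inv
  have heB : ∀ ρ ∈ conjAut X A, e ρ ∈ F.aut B hBc := fun ρ hρ => by
    obtain ⟨r, hr, hr'⟩ := exists_iso_of_mem_aut (autCarrier_le hf.1.le (conjAut_mono hXA A hρ))
    refine mem_aut_of_forall ((hg.comp hr).comp hf).1 fun u => ?_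
    obtain ⟨a, rfl⟩ := hf.equiv.surjective u
    rw [he, hr']
    simp [hgf a a.2]
  -- The lift `f` of `k` intertwines conjugation by `x` and by `y` only modulo `K`, so it need not
  -- extend to `X`. The correction `c` moves the transported automorphisms into $\mathrm{Aut}_P(B)$,
  -- so $c\circ f$ does extend; as `c` is trivial modulo `K`, it still induces `k`.
  obtain ⟨c, hc, hcS⟩ := hSyl.exists_conj_of_mul (C := F.autMod K hBc)
    (R := (conjAut X A).map e.toMonoidHom) (autMod_le _)
    (fun h hh c hc => autMod_normal hK hBc hh hc) ((isPGroup_conjAut hG X A).map _) (by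
      rintro _ ⟨ρ, hρ, rfl⟩
      obtain ⟨x, hx, hρx⟩ := id hρ
      obtain ⟨hxA, y, hy, h₁⟩ := hX x hx
      obtain ⟨s, hs, hsy⟩ := exists_mem_conjAut hy hy
      have hs' := autCarrier_le hBc hs
      refine ⟨s, hs, s⁻¹ * e ρ, ⟨mul_mem (inv_mem hs') (heB ρ hρ), fun u => ?_⟩, by
        rw [mul_inv_cancel_left]; rfl⟩
      obtain ⟨a, rfl⟩ := hf.equiv.surjective u
      have h₂ := h₁ a a.2
      obtain ⟨t, ht, hts⟩ := exists_iso_of_mem_aut (inv_mem hs')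
      have h₃ : (hf.equiv a : G) = t (y⁻¹ * f a * y) := by
        have := congrArg Subtype.val (MulAut.inv_apply_self _ s (hf.equiv a))
        rw [← this, hts, hsy]
        rfl
      have h₄ : ((s⁻¹ * e ρ) (hf.equiv a) : G) = t (f (x⁻¹ * a * x)) := by
        rw [MulAut.mul_apply, hts, he, hρx]
      have h₅ : y⁻¹ * f a * y ∈ B := (mem_normalizerIn.1 hy).1 _ (hf.mem a.2)
      have h₆ := hf.mem ((mem_normalizerIn.1 hxA).1 a a.2)
      rw [h₃, h₄, ← ht.1.map_inv h₅, ← ht.1.map_mul (inv_mem h₅) h₆]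
      exact hK.mem ht.1 (mul_mem (inv_mem h₅) h₆) h₂)
  obtain ⟨γ, hγ, hcγ⟩ := exists_iso_of_mem_aut hc.1
  have hf₁ := hf.comp hγ
  obtain ⟨φ, hφ, hφf⟩ := hF.exists_extension hf₁ hB (N := X) (fun x hx => by
    have hxA := hXA hx
    obtain ⟨ρ, hρ, hρx⟩ := exists_mem_conjAut hxA hx
    obtain ⟨y, hy, h₁⟩ := hcS _ ⟨ρ, hρ, rfl⟩
    refine ⟨hxA, y, hy, fun a ha => ?_⟩
    have h₂ := h₁ (c (hf.equiv ⟨a, ha⟩))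
    change ((c * e ρ * c⁻¹) (c (hf.equiv ⟨a, ha⟩)) : G) = _ at h₂
    rw [MulAut.mul_apply, MulAut.inv_apply_self, MulAut.mul_apply, hcγ, hcγ, he, hρx] at h₂
    exact h₂)
  have hφX := hφ.restrict (le_sup_right (a := A))
  obtain ⟨k', hk', hkφ⟩ := exists_factor_mor hK (le_comap_mk N) hφX
  rw [map_comap_mk] at hk'
  refine ⟨k', hk', fun b hb => ?_⟩
  obtain ⟨a, rfl⟩ := mk_surjective b
  rw [hkφ a (hRN hb), hφf a hb, hfk a hb, eq_comm, mk_eq_iff]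
  have := hc.2 ⟨f a, hf.mem hb⟩
  rwa [hcγ] at this

end FusionSystem

/-! ### Normal subgroups, invariant subsystems and $O_p$ -/

namespace FusionSystem

variable {G : Type u} [Group G] {E F : FusionSystem G} {A B C N O U T K M : Subgroup G}
  {f g : G → G} {p : ℕ}

lemma Mor.mem_of_sup (hf : F.Mor (A ⊔ B) f) (hA : ∀ x ∈ A, f x ∈ C) (hB : ∀ x ∈ B, f x ∈ C) :
    ∀ x ∈ A ⊔ B, f x ∈ C := by
  let φ : (A ⊔ B : Subgroup G) →* G :=
    F.carrier.subtype.comp (hf.hom (S := F.carrier) fun x hx => hf.mem hx)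
  have hle : A ⊔ B ≤ (C.comap φ).map (A ⊔ B).subtype :=
    sup_le (fun x hx => ⟨⟨x, le_sup_left (a := A) hx⟩, hA x hx, rfl⟩)
      fun x hx => ⟨⟨x, le_sup_right (a := A) hx⟩, hB x hx, rfl⟩
  intro x hx
  obtain ⟨y, hy, rfl⟩ := hle hx
  exact hy

lemma le_Op (h : F.IsNormalSubgroup N) : N ≤ F.Op := le_sSup h

section Normal

variable [Finite G]

lemma isNormalSubgroup_iff : F.IsNormalSubgroup N ↔ N ≤ F.carrier ∧ ∀ A f, F.Mor A f →
    ∃ f', F.Mor (N ⊔ A) f' ∧ (∀ x ∈ A, f' x = f x) ∧ ∀ x ∈ N, f' x ∈ N := by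
  refine and_congr_right fun hN => ⟨fun h A f hf => ?_, fun h => ?_⟩
  · have hφ := hf.hom_mem_Hom (fun x hx => hf.mem hx) le_rfl
    rw [congrFun (congrFun (congrArg PrefusionSystem.Hom h) A) F.carrier] at hφ
    obtain ⟨-, -, -, φ', h₁, ⟨h₂, h₃⟩, h₄⟩ := hφ
    refine ⟨ext φ', mor_ext h₁, fun x hx => ?_, fun x hx => ?_⟩
    · rw [ext_of_mem φ' (h₂ hx)]
      exact h₃ ⟨x, hx⟩
    · have hx' := le_sup_left (a := N) (b := A) hx
      refine h₄.le ?_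
      exact ⟨⟨x, hx'⟩, hx, (ext_of_mem φ' hx').symm⟩
  · have hc : F.normalizerIn N = F.carrier := by
      refine le_antisymm inf_le_right fun k hk => mem_normalizerIn_of_finite hk fun y hy => ?_
      obtain ⟨f', h₁, h₂, h₃⟩ := h N _ (mor_conj hk hN)
      rw [← h₂ y hy]
      exact h₃ y hy
    refine PrefusionSystem.ext hc.symm ?_
    funext R S
    ext φ
    refine ⟨fun hφ => ?_, fun hφ => hφ.1⟩
    obtain ⟨hR, hS⟩ := F.le_carrier hφ
    refine ⟨hφ, hc ▸ hR, hc ▸ hS, ?_⟩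
    obtain ⟨f', h₁, h₂, h₃⟩ := h R _ (mor_ext hφ)
    have hmem := h₁.mem_of_sup (C := N ⊔ S) (fun x hx => le_sup_left (a := N) (h₃ x hx))
      fun x hx => le_sup_right (a := N) (by
        rw [h₂ x hx, ext_of_mem φ hx]
        exact (φ _).2)
    have hφ' := h₁.hom_mem_Hom hmem (sup_le hN hS)
    refine ⟨_, hφ', ⟨le_sup_right, fun x => (h₂ x x.2).trans (ext_coe φ x)⟩, ?_⟩
    have hi : F.Iso f' N N := (h₁.restrict le_sup_left).iso_of_card h₃ le_rfl
    ext y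
    constructor
    · rintro ⟨x, hx, rfl⟩
      exact h₃ x hx
    · intro hy
      obtain ⟨x, hx, rfl⟩ := hi.exists_eq hy
      exact ⟨⟨x, le_sup_left (a := N) hx⟩, hx, rfl⟩

lemma isNormalSubgroup_bot : F.IsNormalSubgroup ⊥ := by
  refine isNormalSubgroup_iff.2 ⟨bot_le, fun A f hf => ⟨f, by rwa [bot_sup_eq], fun _ _ => rfl, ?_⟩⟩
  intro x hx
  rw [Subgroup.mem_bot] at hx ⊢
  rw [hx, hf.map_one]

lemma isNormalSubgroup_sup (hM : F.IsNormalSubgroup M) (hN : F.IsNormalSubgroup N) :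
    F.IsNormalSubgroup (M ⊔ N) := by
  rw [isNormalSubgroup_iff] at *
  refine ⟨sup_le hM.1 hN.1, fun A f hf => ?_⟩
  obtain ⟨f', h₁, h₂, h₃⟩ := hN.2 A f hf
  obtain ⟨f'', h₄, h₅, h₆⟩ := hM.2 _ f' h₁
  have hN' : ∀ x ∈ N, f'' x ∈ N := fun x hx => by
    rw [h₅ x (le_sup_left (a := N) hx)]
    exact h₃ x hx
  refine ⟨f'', by rwa [sup_assoc], fun x hx => ?_, fun x hx => ?_⟩
  · rw [h₅ x (le_sup_right (a := N) hx), h₂ x hx]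
  · exact (h₄.restrict (sup_le_sup_left le_sup_left M)).mem_of_sup
      (fun x hx => le_sup_left (a := M) (h₆ x hx)) (fun x hx => le_sup_right (a := M) (hN' x hx)) x hx

lemma isNormalSubgroup_Op : F.IsNormalSubgroup F.Op := by
  obtain ⟨N, hN, hm⟩ := (Set.toFinite {Q | F.IsNormalSubgroup Q}).exists_maximal
    ⟨⊥, isNormalSubgroup_bot⟩
  have : F.Op = N := by
    refine le_antisymm (sSup_le fun Q hQ => ?_) (le_Op hN)
    exact le_sup_right.trans (hm (isNormalSubgroup_sup hN hQ) le_sup_left)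
  rwa [this]

lemma stronglyClosed_of_isNormalSubgroup (h : F.IsNormalSubgroup N) : F.StronglyClosed N := by
  rw [isNormalSubgroup_iff] at h
  refine stronglyClosed_iff.2 ⟨h.1, fun A f hf hA x hx => ?_⟩
  obtain ⟨f', -, h₂, h₃⟩ := h.2 A f hf
  rw [← h₂ x hx]
  exact h₃ x (hA hx)

/-- In a saturated system a strongly closed subgroup `O` that acts nilpotently on a series of
strongly closed subgroups is normal. -/
theorem IsSaturated.isNormalSubgroup_of_series [Fact p.Prime] (hG : IsPGroup p G)
    (hF : F.IsSaturated p) (hO : F.StronglyClosed O) (d : ℕ → Subgroup G)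
    (hd : ∀ i, F.StronglyClosed (d i)) (hd0 : d 0 = F.carrier) {m : ℕ} (hm : d (m + 1) = ⊥)
    (hc : ∀ i, ∀ u ∈ d i, ∀ o ∈ O, u⁻¹ * (o⁻¹ * u * o) ∈ d (i + 1)) : F.IsNormalSubgroup O := by
  have hT : F.StronglyClosed F.carrier := hd0 ▸ hd 0
  have hbot : F.StronglyClosed ⊥ := hm ▸ hd (m + 1)
  suffices key : ∀ A f, F.Mor A f → F.ExtendsMod O ⊥ A f by
    refine isNormalSubgroup_iff.2 ⟨hO.1, fun A f hf => ?_⟩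
    obtain ⟨f', h₁, h₂⟩ := key A f hf
    refine ⟨f', by rwa [sup_comm], fun x hx => ?_, fun x hx => ?_⟩
    · exact (inv_mul_eq_one.1 (h₂ x hx)).symm
    · exact hO.mem h₁ (le_sup_right (a := A) hx) hx
  intro A f hf
  refine hF.fusion_induction hG hT (fun A f => F.ExtendsMod O ⊥ A f)
    (fun A B f hB _ _ h => h.restrict hB)
    (fun A B C f g _ hf _ h h' => h.comp hO hbot bot_le hf h')
    (fun A B f g _ hf hg h => h.inv hO hbot bot_le hf hg) (fun A f g e h => h.congr e)
    (fun f hf => ⟨f, by rwa [sup_eq_left.2 hO.1], fun x _ => by simp⟩) ?_ hf.le hf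
  intro U f hUlt hU hf ih
  by_cases hOU : O ≤ U
  · exact ⟨f, by rw [sup_eq_left.2 hOU]; exact hf.1, fun x _ => by simp⟩
  obtain ⟨hUc, hS⟩ := hF.fullyAutomized hG hU
  have hinv : ∀ α ∈ F.aut U hUc, ∀ i, ∀ u : U, (u : G) ∈ d i → (α u : G) ∈ d i :=
    fun α hα i u hu => by
      obtain ⟨a, ha, ha'⟩ := exists_iso_of_mem_aut hα
      rw [ha']
      exact (hd i).mem ha.1 u.2 hu
  -- The stabilizer in $\mathrm{Aut}_{\mathcal F}(U)$ of the series $U\cap d_i$. Being a normal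
  -- $p$-subgroup it lies in $\mathrm{Aut}_P(U)$, and it contains the action of $N_O(U)$; hence `f`
  -- extends over $N_O(U)$.
  let X : Subgroup (MulAut U) :=
    { carrier := {α | α ∈ F.aut U hUc ∧ ∀ i, ∀ u : U, (u : G) ∈ d i → (u : G)⁻¹ * α u ∈ d (i + 1)}
      one_mem' := ⟨one_mem _, fun i u _ => by simp⟩
      mul_mem' := by
        rintro α β ⟨hα, h⟩ ⟨hβ, h'⟩
        refine ⟨mul_mem hα hβ, fun i u hu => ?_⟩
        have := mul_mem (h' i u hu) (h i (β u) (hinv β hβ i u hu))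
        rw [MulAut.mul_apply]
        simpa [mul_assoc] using this
      inv_mem' := by
        rintro α ⟨hα, h⟩
        refine ⟨inv_mem hα, fun i u hu => ?_⟩
        have := inv_mem (h i (α⁻¹ u) (hinv _ (inv_mem hα) i u hu))
        rw [MulAut.apply_inv_self] at this
        simpa using this }
  have hXle : X ≤ F.aut U hUc := fun α hα => hα.1
  have hXn : ∀ h ∈ F.aut U hUc, ∀ γ ∈ X, h * γ * h⁻¹ ∈ X := by
    intro h hh γ hγ
    refine ⟨mul_mem (mul_mem hh hγ.1) (inv_mem hh), fun i u hu => ?_⟩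
    obtain ⟨a, ha, ha'⟩ := exists_iso_of_mem_aut hh
    have hv := hinv _ (inv_mem hh) i u hu
    obtain ⟨v, rfl⟩ := h.surjective u
    rw [MulAut.inv_apply_self] at hv
    rw [MulAut.mul_apply, MulAut.inv_apply_self, MulAut.mul_apply, ha', ha', ← ha.1.map_inv v.2,
      ← ha.1.map_mul (inv_mem v.2) (γ v).2]
    exact (hd _).mem ha.1 (mul_mem (inv_mem v.2) (γ v).2) (hγ.2 i v hv)
  have hXp : IsPGroup p X := by
    obtain ⟨k, hk⟩ := IsPGroup.iff_card.1 hG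
    -- If `γ` multiplies `u` by $v\in d_{i+1}$, it fixes $v$ modulo $d_{i+2}$, so $\gamma^n$
    -- multiplies `u` by $v^n$ modulo $d_{i+2}$. For $n=p^k=|G|$ this is trivial, and $\gamma^n$
    -- acts trivially one layer deeper.
    have step : ∀ i, ∀ γ ∈ X, (∀ u : U, (u : G)⁻¹ * γ u ∈ d (i + 1)) →
        ∀ n : ℕ, ∀ u : U, ((u : G) * ((u : G)⁻¹ * γ u) ^ n)⁻¹ * (γ ^ n) u ∈ d (i + 2) := by
      intro i γ hγ h n
      induction n with
      | zero => simp
      | succ n ih =>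
        intro u
        have h₁ := ih u
        have h₂ := (pow_mem hγ n).2 (i + 1) (u⁻¹ * γ u) (h u)
        have h₃ := mul_mem ((hd (i + 2)).conj_mem ((hd (i + 1)).1 (h u)) h₁) h₂
        have e : (γ ^ (n + 1)) u = (γ ^ n) u * (γ ^ n) (u⁻¹ * γ u) := by
          rw [← map_mul, mul_inv_cancel_left, pow_succ, MulAut.mul_apply]
        rw [e]
        convert h₃ using 1
        simp only [Subgroup.coe_mul, InvMemClass.coe_inv, pow_succ]
        group
    have key : ∀ i, ∀ γ ∈ X, ∀ u : U, (u : G)⁻¹ * (γ ^ (p ^ (k * i))) u ∈ d (i + 1) := by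
      intro i γ hγ
      induction i with
      | zero => exact fun u => by simpa using hγ.2 0 u (hd0 ▸ hUc u.2)
      | succ i ih =>
        intro u
        have h₁ := step i _ (pow_mem hγ (p ^ (k * i))) ih (p ^ k) u
        rw [← hk, pow_card_eq_one', mul_one, ← pow_mul, hk, ← pow_add] at h₁
        rwa [mul_add, mul_one]
    rintro ⟨γ, hγ⟩
    refine ⟨k * m, Subtype.ext ?_⟩
    ext u
    have h₁ := key m γ hγ u
    rw [hm, Subgroup.mem_bot, inv_mul_eq_one] at h₁
    exact h₁.symm
  have hXS := hS.le_of_normal hXle hXn hXp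
  obtain ⟨α, hα, hαf⟩ := exists_aut hf
  obtain ⟨t, ht, htf⟩ := hF.exists_extension hf hU (N := F.normalizerIn U ⊓ O) (fun x hx => by
    obtain ⟨β, hβ, hβx⟩ := exists_mem_conjAut hx.1 hx.1
    have hβX : β ∈ X := ⟨autCarrier_le hUc hβ, fun i u hu => by
      rw [hβx]
      exact hc i u hu x hx.2⟩
    obtain ⟨y, hy, h₁⟩ := hXS (hXn α hα β hβX)
    refine ⟨hx.1, y, hy, fun a ha => ?_⟩
    have h₂ := h₁ (α ⟨a, ha⟩)
    rw [MulAut.mul_apply, MulAut.inv_apply_self, MulAut.mul_apply, hαf, hαf, hβx] at h₂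
    exact h₂)
  exact ((ih _ t (lt_sup_normalizer hG hO hUc hOU) ht.le ht).restrict le_sup_left).congr
    fun x hx => (htf x hx).symm

end Normal

lemma Iso.map_lowerCentralSeries (h : F.Iso f O O) {n : ℕ} {x : G}
    (hx : x ∈ O.lowerCentralSeries n) : f x ∈ O.lowerCentralSeries n := by
  rw [← Subgroup.top_subtype_lowerCentralSeries] at hx ⊢
  obtain ⟨y, hy, rfl⟩ := hx
  refine ⟨h.equiv y, ?_, rfl⟩
  have h₁ : h.equiv.toMonoidHom y ∈ ((⊤ : Subgroup O).lowerCentralSeries n).map _ := ⟨y, hy, rfl⟩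
  rw [Subgroup.map_lowerCentralSeries] at h₁
  exact Subgroup.lowerCentralSeries_mono n le_top h₁

/-- `O` acts trivially on the factors of $P\ge O\ge[O,O]\ge\cdots\ge1$: on $P/O$ because `O` is
normalized by $P$, on the others by construction. -/
theorem IsSaturated.isNormalSubgroup_of_lowerCentralSeries [Finite G] [Fact p.Prime] (hG : IsPGroup p G)
    (hF : F.IsSaturated p) (h : ∀ n, F.StronglyClosed (O.lowerCentralSeries n)) : F.IsNormalSubgroup O := by
  have hO : F.StronglyClosed O := h 0
  have hT : F.StronglyClosed F.carrier :=
    stronglyClosed_iff.2 ⟨le_rfl, fun A f hf _ x hx => hf.mem hx⟩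
  have : Group.IsNilpotent O := (hG.to_subgroup O).isNilpotent
  obtain ⟨m, hm⟩ := (Subgroup.isNilpotent_iff_lowerCentralSeries O).1 this
  refine hF.isNormalSubgroup_of_series hG hO (fun i => Nat.casesOn i F.carrier O.lowerCentralSeries) ?_ rfl
    (m := m) ?_ ?_
  · rintro (_ | i)
    exacts [hT, h i]
  · exact hm
  · rintro (_ | i) u hu o ho
    · change _ ∈ O
      have := mul_mem (hO.conj_mem hu (inv_mem ho)) ho
      simpa [mul_assoc] using this
    · have := Subgroup.commutator_mem_commutator (inv_mem hu) (inv_mem ho)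
      simpa [commutatorElement_def, mul_assoc] using this

lemma mor_of_isSubsystem (h : E.IsSubsystem F.toPrefusionSystem) (hf : E.Mor A f) : F.Mor A f := by
  obtain ⟨S, φ, hφ, e⟩ := hf
  exact ⟨S, φ, h.2 _ _ hφ, e⟩

/-- Invariance, for morphisms given by functions. -/
lemma IsInvariant.mor (h : E.IsInvariant F) {R R' S : Subgroup G} (hRS : R ≤ S)
    (hS : S ≤ E.carrier) {φ ψ χ : G → G} (hφ : E.Mor R φ) (hφS : ∀ x ∈ R, φ x ∈ S)
    (hψ : F.Mor S ψ) (hψR : ψ '' R = R') (hχ : ∀ x ∈ R, χ (ψ x) = ψ (φ x)) : E.Mor R' χ := by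
  obtain ⟨χ', h₁, h₂⟩ := h.2.2 R S hRS hS _ (hφ.hom_mem_Hom hφS hS) _
    (hψ.hom_mem_Hom (fun x hx => hψ.mem hx) le_rfl)
  have hi : image (hψ.hom (S := F.carrier) fun x hx => hψ.mem hx) R = R' := by
    refine SetLike.coe_injective ?_
    rw [← hψR]
    ext y
    constructor
    · rintro ⟨x, hx, rfl⟩
      exact ⟨x, hx, rfl⟩
    · rintro ⟨x, hx, rfl⟩
      exact ⟨⟨x, hRS hx⟩, hx, rfl⟩
  rw [← hi]
  refine (mor_ext h₁).congr fun y hy => ?_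
  rw [ext_of_mem _ hy]
  have hy' := hy
  rw [hi, ← SetLike.mem_coe, ← hψR] at hy'
  obtain ⟨x, hx, rfl⟩ := hy'
  rw [hχ x hx]
  exact (h₂ ⟨x, hx⟩ ⟨_, hy⟩ rfl).symm

/-- `f` is the composite of an `E`-morphism on `A` and an `F`-automorphism of the group on which
`E` is defined. -/
def Factors (E F : FusionSystem G) (A : Subgroup G) (f : G → G) : Prop :=
  ∃ α χ, F.Iso α E.carrier E.carrier ∧ E.Mor A χ ∧ ∀ x ∈ A, f x = α (χ x)

namespace Factors

lemma restrict (h : E.Factors F A f) (hB : B ≤ A) : E.Factors F B f := by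
  obtain ⟨α, χ, h₁, h₂, h₃⟩ := h
  exact ⟨α, χ, h₁, h₂.restrict hB, fun x hx => h₃ x (hB hx)⟩

lemma congr (h : E.Factors F A f) (e : ∀ x ∈ A, g x = f x) : E.Factors F A g := by
  obtain ⟨α, χ, h₁, h₂, h₃⟩ := h
  exact ⟨α, χ, h₁, h₂, fun x hx => by rw [e x hx, h₃ x hx]⟩

/-- $\beta\eta\alpha\chi=(\beta\alpha)(\alpha^{-1}\eta\alpha)\chi$, and invariance puts
$\alpha^{-1}\eta\alpha$ into `E`. -/
lemma comp (hE : E.IsInvariant F) (hf : F.Iso f A B) (h : E.Factors F A f)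
    (h' : E.Factors F B g) : E.Factors F A (g ∘ f) := by
  obtain ⟨α, χ, hα, hχ, hf'⟩ := h
  obtain ⟨β, η, hβ, hη, hg'⟩ := h'
  obtain ⟨α', hα', h₁, h₂⟩ := hα.exists_inv
  obtain ⟨A₁, hA₁⟩ := hχ.exists_iso
  have e : α' '' B = A₁ := by
    rw [← hf.2, ← hA₁.2, ← Set.image_comp]
    refine Set.image_congr fun x hx => ?_
    rw [Function.comp_apply, hf' x hx, h₁ _ (hχ.mem hx)]
  have h₃ : E.Mor A₁ (α' ∘ η ∘ α) := hE.mor hη.le le_rfl hη (fun x hx => hη.mem hx) hα'.1 e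
    fun x hx => by simp [h₂ x (hη.le hx)]
  refine ⟨β ∘ α, (α' ∘ η ∘ α) ∘ χ, hα.comp hβ, hχ.comp h₃ fun x hx => hA₁.mem hx, fun x hx => ?_⟩
  simp only [Function.comp_apply]
  rw [h₂ _ (hη.mem (by rw [← hf' x hx]; exact hf.mem hx)), hg' _ (hf.mem hx), hf' x hx]

lemma inv (hE : E.IsInvariant F) (hf : F.Iso f A B) (hg : ∀ x ∈ A, g (f x) = x)
    (h : E.Factors F A f) : E.Factors F B g := by
  obtain ⟨α, χ, hα, hχ, hf'⟩ := h
  obtain ⟨α', hα', h₁, h₂⟩ := hα.exists_inv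
  obtain ⟨A₁, hA₁⟩ := hχ.exists_iso
  obtain ⟨χ', hχ', h₃, h₄⟩ := hA₁.exists_inv
  have e : α '' A₁ = B := by
    rw [← hf.2, ← hA₁.2, ← Set.image_comp]
    exact Set.image_congr fun x hx => (hf' x hx).symm
  refine ⟨α', α ∘ χ' ∘ α', hα', hE.mor hA₁.le le_rfl hχ'.1 (fun x hx => hχ'.1.mem hx) hα.1 e
    fun x hx => by simp [h₁ x (hA₁.le hx)], fun y hy => ?_⟩
  obtain ⟨x, hx, rfl⟩ := hf.exists_eq hy
  rw [hg x hx, hf' x hx]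
  simp only [Function.comp_apply]
  rw [h₁ _ (hχ.mem hx), h₃ x hx, h₁ x (hχ.le hx)]

end Factors

lemma IsSubnormalIn.isSaturated (h : E.IsSubnormalIn p F) (hF : F.IsSaturated p) :
    E.IsSaturated p := by
  induction h using Relation.ReflTransGen.head_induction_on with
  | refl => exact hF
  | head h _ _ => exact h.2

lemma ofSubgroup_mor_iff {Q : Subgroup G} : (ofSubgroup Q).Mor A f ↔
    A ≤ Q ∧ ∃ g ∈ Q, ∀ x ∈ A, f x = g⁻¹ * x * g := by
  constructor
  · rintro ⟨S, φ, ⟨hA, -, g, hg, h⟩, e⟩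
    exact ⟨hA, g, hg, fun x hx => by rw [← h ⟨x, hx⟩, e ⟨x, hx⟩]⟩
  · rintro ⟨hA, g, hg, h⟩
    exact (mor_conj (F := ofSubgroup Q) hg hA).congr h

variable [Finite G]

/-- The Frattini property of invariant subsystems. -/
theorem IsInvariant.factors [Fact p.Prime] (hG : IsPGroup p G) (hF : F.IsSaturated p)
    (hE : E.IsInvariant F) (hA : A ≤ E.carrier) (hf : F.Mor A f) : E.Factors F A f := by
  refine hF.fusion_induction hG hE.2.1 (fun A f => E.Factors F A f)
    (fun A B f hB _ _ h => h.restrict hB) (fun A B C f g _ hf _ h h' => h.comp hE hf h')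
    (fun A B f g _ hf hg h => h.inv hE hf hg) (fun A f g e h => h.congr e)
    (fun f hf => ⟨f, id, hf.iso_of_card (fun x hx => hE.2.1.mem hf hx hx) le_rfl, mor_id le_rfl,
      fun _ _ => rfl⟩) ?_ hA hf
  intro U f hUlt hU hf ih
  obtain ⟨hUc, hS⟩ := hF.fullyAutomized hG hU
  obtain ⟨α, hα, hαf⟩ := exists_aut hf
  have hle : E.aut U hUlt.le ≤ F.aut U hUc := fun c hc => hE.1.2 _ _ hc
  -- Invariance makes $\mathrm{Aut}_{\mathcal E}(U)$ normal in $\mathrm{Aut}_{\mathcal F}(U)$. The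
  -- part `c` is already in `E`; the part `n` normalizes the action of $N_P(U)\cap T$, with $T$ the
  -- group of `E`, so it extends to this group, which is larger than `U`.
  obtain ⟨c, hc, n, hn, rfl, hns⟩ := hS.frattini hle (fun h hh c hc => by
    obtain ⟨a, ha, ha'⟩ := exists_iso_of_mem_aut hh
    obtain ⟨b, hb, hb'⟩ := exists_iso_of_mem_aut hc
    obtain ⟨a', -, h₁, h₂⟩ := ha.exists_inv
    refine mem_aut_of_forall (f := a ∘ b ∘ a') (hE.mor le_rfl hUlt.le hb.1 (fun x hx => hb.mem hx)
      ha.1 ha.2 fun x hx => by simp [h₁ x hx]) fun u => ?_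
    obtain ⟨v, rfl⟩ := h.surjective u
    rw [MulAut.mul_apply, MulAut.inv_apply_self, MulAut.mul_apply, ha', ha', hb']
    simp [h₁ v v.2]) hα
  obtain ⟨c', hc', hcc⟩ := exists_iso_of_mem_aut hc
  obtain ⟨n', hn', hnn⟩ := exists_iso_of_mem_aut hn
  obtain ⟨t, ht, htn⟩ := hF.exists_extension hn' hU (N := F.normalizerIn U ⊓ E.carrier)
    (fun x hx => by
    obtain ⟨β, hβ, hβx⟩ := exists_mem_conjAut hx.1 hx.1
    have hβC : β ∈ E.aut U hUlt.le := mem_aut_of_forall (mor_conj hx.2 hUlt.le) hβx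
    obtain ⟨⟨y, hy, h₁⟩, -⟩ := hns β ⟨hβ, hβC⟩
    refine ⟨hx.1, y, hy, fun a ha => ?_⟩
    have h₂ := h₁ (n ⟨a, ha⟩)
    rw [MulAut.mul_apply, MulAut.inv_apply_self, MulAut.mul_apply, hnn, hnn, hβx] at h₂
    exact h₂)
  have hlt := lt_normalizerIn hG hE.2.1.1 hUlt
  rw [sup_eq_right.2 hlt.le] at ht
  have h₁ := ((ih _ t hlt inf_le_right ht).restrict hlt.le).congr fun x hx => (htn x hx).symm
  have h₂ : E.Factors F U c' := ⟨id, c', iso_id hE.2.1.1, hc'.1, fun _ _ => rfl⟩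
  refine (h₁.comp hE hn' h₂).congr fun x hx => ?_
  rw [← hαf ⟨x, hx⟩, MulAut.mul_apply, hcc, hnn]
  rfl

/-- Conjugation by `α` carries `E`-morphisms to `E`-morphisms, so `α` permutes the subgroups normal
in `E`; in particular it stabilizes $O_p(\mathcal E)$. -/
lemma IsInvariant.isNormalSubgroup_of_iso (hE : E.IsInvariant F) {α : G → G}
    (hα : F.Iso α E.carrier E.carrier) (hN : E.IsNormalSubgroup N) (hM : α '' N = M) :
    E.IsNormalSubgroup M := by
  rw [isNormalSubgroup_iff] at hN
  obtain ⟨α', hα', h₁, h₂⟩ := hα.exists_inv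
  refine isNormalSubgroup_iff.2 ⟨fun y hy => ?_, fun A f hf => ?_⟩
  · rw [← SetLike.mem_coe, ← hM] at hy
    obtain ⟨x, hx, rfl⟩ := hy
    exact hα.mem (hN.1 hx)
  · obtain ⟨A₁, hle, hA₁⟩ := hα'.restrict hf.le
    have h₃ : E.Mor A₁ (α' ∘ f ∘ α) := hE.mor hf.le le_rfl hf (fun x hx => hf.mem hx) hα'.1 hA₁.2
      fun x hx => by simp [h₂ x (hf.le hx)]
    obtain ⟨h, h₄, h₅, h₆⟩ := hN.2 _ _ h₃
    obtain ⟨D, -, hD⟩ := hα.restrict h₄.le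
    have h₇ : E.Mor D (α ∘ h ∘ α') := hE.mor h₄.le le_rfl h₄ (fun x hx => h₄.mem hx) hα.1 hD.2
      fun x hx => by simp [h₁ x (h₄.le hx)]
    refine ⟨_, h₇.restrict (sup_le (fun y hy => ?_) fun y hy => ?_), fun y hy => ?_, fun y hy => ?_⟩
    · rw [← SetLike.mem_coe, ← hM] at hy
      obtain ⟨x, hx, rfl⟩ := hy
      exact hD.mem (le_sup_left (a := N) hx)
    · rw [← h₂ y (hf.le hy)]
      exact hD.mem (le_sup_right (a := N) (hA₁.mem hy))
    · simp only [Function.comp_apply]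
      rw [h₅ _ (hA₁.mem hy)]
      simp [h₂ y (hf.le hy), h₂ _ (hf.mem hy)]
    · rw [← SetLike.mem_coe, ← hM] at hy ⊢
      obtain ⟨x, hx, rfl⟩ := hy
      exact ⟨h x, h₆ x hx, by simp [h₁ x (hN.1 hx)]⟩

/-- If `E` is an invariant subsystem of the saturated system `F`, then `O_p(E) ≤ O_p(F)`. -/
theorem IsInvariant.Op_le [Fact p.Prime] (hG : IsPGroup p G) (hF : F.IsSaturated p)
    (hE : E.IsInvariant F) : E.Op ≤ F.Op := by
  have hN := E.isNormalSubgroup_Op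
  have hN' := isNormalSubgroup_iff.1 hN
  -- Strong closure of $O_p(\mathcal E)$ alone would not make it normal in `F`; that of all its
  -- lower central terms does. Both factors of an `F`-morphism act on these terms through
  -- automorphisms of $O_p(\mathcal E)$.
  refine le_Op (hF.isNormalSubgroup_of_lowerCentralSeries hG fun n => ?_)
  have hle := (Subgroup.lowerCentralSeries_le_self E.Op n).trans hN'.1
  refine stronglyClosed_iff.2 ⟨hle.trans hE.1.1, fun A f hf hA x hx => ?_⟩
  obtain ⟨α, χ, hα, hχ, h⟩ := hE.factors hG hF (hA.trans hle) hf
  rw [h x hx]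
  obtain ⟨k, h₁, h₂, h₃⟩ := hN'.2 A χ hχ
  have hk : E.Iso k E.Op E.Op := (h₁.restrict le_sup_left).iso_of_card h₃ le_rfl
  have hα' : F.Iso α E.Op E.Op := by
    obtain ⟨B, -, hB⟩ := hα.restrict hN'.1
    refine hB.1.iso_of_card (fun x hx => ?_) le_rfl
    exact le_Op (hE.isNormalSubgroup_of_iso hα hN hB.2) (hB.mem hx)
  rw [← h₂ x hx]
  exact hα'.map_lowerCentralSeries (hk.map_lowerCentralSeries (hA hx))

theorem IsSubnormalIn.Op_le [Fact p.Prime] (hG : IsPGroup p G) (hF : F.IsSaturated p)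
    (h : E.IsSubnormalIn p F) : E.Op ≤ F.Op := by
  induction h using Relation.ReflTransGen.head_induction_on with
  | refl => exact le_rfl
  | head h h' ih => exact (h.1.Op_le hG (IsSubnormalIn.isSaturated h' hF)).trans ih

lemma le_Op_ofSubgroup (Q : Subgroup G) : Q ≤ (ofSubgroup Q).Op := by
  refine le_Op (isNormalSubgroup_iff.2 ⟨le_rfl, fun A f hf => ?_⟩)
  obtain ⟨hA, g, hg, h⟩ := ofSubgroup_mor_iff.1 hf
  exact ⟨fun x => g⁻¹ * x * g, ofSubgroup_mor_iff.2 ⟨sup_le le_rfl hA, g, hg, fun _ _ => rfl⟩,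
    fun x hx => (h x hx).symm, fun x hx => mul_mem (mul_mem (inv_mem hg) hx) hg⟩

end FusionSystem

/-! ### Simple systems and strongly closed subgroups -/

namespace FusionSystem

variable {G : Type u} [Group G] {E F : FusionSystem G} {A B C N O Q U T K M : Subgroup G}
  {f g : G → G} {p : ℕ}

lemma stronglyClosed_bot : F.StronglyClosed ⊥ :=
  stronglyClosed_iff.2 ⟨bot_le, fun A f hf hA x hx => by
    have hx' := hA hx
    rw [Subgroup.mem_bot] at hx' ⊢
    rw [hx', hf.map_one]⟩

lemma normal_of_stronglyClosed (hF : F.carrier = ⊤) (hK : F.StronglyClosed K) : K.Normal :=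
  ⟨fun k hk x => by simpa using hK.conj_mem (x := x⁻¹) (hF ▸ Subgroup.mem_top _) hk⟩

/-- The identity of the carrier is a morphism, so the carrier can be recovered from the morphism
sets. -/
lemma eq_of_Hom_eq (h : E.Hom = F.Hom) : E = F := by
  have key : ∀ {E F : FusionSystem G}, E.Hom = F.Hom → E.carrier ≤ F.carrier := fun {E F} h => by
    have h₁ : MonoidHom.id E.carrier ∈ E.Hom E.carrier E.carrier :=
      E.conj_mem 1 (one_mem _) le_rfl le_rfl _ fun x => by simp
    rw [h] at h₁
    exact (F.le_carrier h₁).1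
  have h₁ : E.toPrefusionSystem = F.toPrefusionSystem :=
    PrefusionSystem.ext (le_antisymm (key h) (key h.symm)) h
  cases E
  cases F
  cases h₁
  rfl

lemma IsMinimalSubnormalIn.isSimple (hF : F.IsSaturated p) (h : E.IsMinimalSubnormalIn p F) :
    E.IsSimple p :=
  ⟨h.1.isSaturated hF, h.2.1, fun D hD => or_iff_not_imp_left.2 fun hne =>
    h.2.2 D (Relation.ReflTransGen.head hD h.1) hne hD.1.1⟩

lemma isSaturated_ofSubgroup (hG : IsPGroup p G) (Q : Subgroup G) :
    (ofSubgroup Q).IsSaturated p := by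
  refine isSaturated_of ⟨le_rfl, autCarrier_le _, isPGroup_conjAut hG _ _, fun R hR _ hle =>
    le_antisymm (fun α hα => ?_) hle⟩ fun f A B N hf _ _ hN => ?_
  · obtain ⟨-, -, g, hg, h⟩ := hR hα
    exact ⟨g, le_normalizerIn (F := ofSubgroup Q) le_rfl hg, h⟩
  · obtain ⟨hA, g, hg, h⟩ := ofSubgroup_mor_iff.1 hf.1
    refine ⟨fun x => g⁻¹ * x * g, ofSubgroup_mor_iff.2 ⟨fun x hx => ?_, g, hg, fun _ _ => rfl⟩,
      fun x hx => (h x hx).symm⟩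
    exact (mem_normalizerIn.1 (hN x hx).1).2.2

variable [Finite G]

instance : Finite (FusionSystem G) :=
  have (A B : Subgroup G) : Finite (A →* B) := DFunLike.finite _
  Finite.of_injective (fun F : FusionSystem G => F.Hom) fun _ _ h => eq_of_Hom_eq h

lemma exists_isMinimalSubnormalIn (hF : F.carrier ≠ ⊥) :
    ∃ E : FusionSystem G, E.IsMinimalSubnormalIn p F := by
  obtain ⟨E, ⟨h₁, h₂⟩, h₃⟩ := (Set.toFinite {D : FusionSystem G | D.IsSubnormalIn p F ∧
    D.carrier ≠ ⊥}).exists_minimalFor (fun D => D.Hom) _ ⟨F, Relation.ReflTransGen.refl, hF⟩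
  refine ⟨E, h₁, h₂, fun D h₄ h₅ h₆ => eq_of_Hom_eq ?_⟩
  exact le_antisymm h₆.2 (h₃ ⟨h₄, h₅⟩ h₆.2)

/-- An `F`-morphism `ψ` on `S` extends to some `k` on `NS` and turns conjugation by $g\in N$ into
conjugation by $k(g)\in N$. -/
lemma isNormalIn_ofSubgroup (hG : IsPGroup p G) (h : F.IsNormalSubgroup N) :
    (ofSubgroup N).IsNormalIn p F := by
  refine ⟨⟨⟨h.1, ?_⟩, stronglyClosed_of_isNormalSubgroup h, ?_⟩, isSaturated_ofSubgroup hG N⟩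
  · rintro R S φ ⟨hR, hS, g, hg, e⟩
    exact F.conj_mem g (h.1 hg) (hR.trans h.1) (hS.trans h.1) φ e
  · rintro R S hRS hS φ ⟨hR, -, g, hg, e⟩ ψ hψ
    obtain ⟨k, h₁, h₂, h₃⟩ := (isNormalSubgroup_iff.1 h).2 _ _ (mor_ext hψ)
    have hk : ∀ x : S, k x = ψ x := fun x => (h₂ x x.2).trans (ext_coe ψ x)
    have hle : image ψ R ≤ N := by
      rintro _ ⟨x, hx, rfl⟩
      change (ψ x : G) ∈ N
      rw [← hk]
      exact h₃ x (hS x.2)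
    have hχ := mor_conj (F := ofSubgroup N) (k := k g) (h₃ g hg) hle
    refine ⟨_, hχ.hom_mem_Hom (S := N) (fun x hx => hχ.mem hx) le_rfl, fun x y hy => ?_⟩
    change (k g)⁻¹ * y * k g = _
    rw [hy, ← hk, ← hk, e, h₁.map_conj (le_sup_left (a := N) (hR x.2)) (le_sup_left (a := N) hg)]

/-- An abelian strongly closed `M` is normal, by the series $P\ge M\ge1$, so simplicity gives
$\mathcal F=\mathcal F_M(M)$. There all morphisms are inclusions, so a subgroup of order $p$ is
normal too, and simplicity applies again. -/
lemma IsSimple.exists_prime [Fact p.Prime] (hG : IsPGroup p G) (hF : F.IsSimple p)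
    (hM : F.StronglyClosed M) (hM1 : M ≠ ⊥) (hc : ⁅M, M⁆ = ⊥) :
    ∃ Q : Subgroup G, (Nat.card Q).Prime ∧ F = ofSubgroup Q := by
  have hN : F.IsNormalSubgroup M := hF.1.isNormalSubgroup_of_lowerCentralSeries hG fun n => by
    rcases n with _ | n
    · exact hM
    · have : M.lowerCentralSeries (n + 1) = ⊥ :=
        le_bot_iff.1 ((M.lowerCentralSeries_antitone (Nat.le_add_left 1 n)).trans hc.le)
      rw [this]
      exact stronglyClosed_bot
  have hFM : ofSubgroup M = F := (hF.2.2 _ (isNormalIn_ofSubgroup hG hN)).resolve_left hM1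
  have hcomm : ∀ x ∈ M, ∀ y ∈ M, x * y = y * x := fun x hx y hy =>
    commutatorElement_eq_one_iff_mul_comm.1 (by
      rw [← Subgroup.mem_bot, ← hc]
      exact Subgroup.commutator_mem_commutator hx hy)
  have hp : p ∣ Nat.card M := (hG.to_subgroup M).card_eq_or_dvd.resolve_left fun e =>
    hM1 (Subgroup.card_eq_one.1 e)
  obtain ⟨z, hz⟩ := exists_prime_orderOf_dvd_card' p hp
  have hQ : Nat.card (Subgroup.zpowers (z : G)) = p := by
    rw [Nat.card_zpowers, Subgroup.orderOf_coe, hz]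
  have hzM : Subgroup.zpowers (z : G) ≤ M := Subgroup.zpowers_le.2 z.2
  have hZ : F.IsNormalSubgroup (Subgroup.zpowers (z : G)) := by
    rw [← hFM]
    refine isNormalSubgroup_iff.2 ⟨hzM, fun A f hf => ?_⟩
    obtain ⟨hA, g, hg, h⟩ := ofSubgroup_mor_iff.1 hf
    refine ⟨id, mor_id (sup_le hzM hA), fun x hx => ?_, fun x hx => hx⟩
    rw [h x hx, mul_assoc, hcomm x (hA hx) g hg, inv_mul_cancel_left]
    rfl
  refine ⟨_, by rw [hQ]; exact Fact.out,
    ((hF.2.2 _ (isNormalIn_ofSubgroup hG hZ)).resolve_left ?_).symm⟩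
  intro e
  change Subgroup.zpowers (z : G) = ⊥ at e
  rw [e, Subgroup.card_bot] at hQ
  exact (Fact.out : p.Prime).ne_one hQ.symm

lemma stronglyClosed_lowerCentralSeries (hN : F.IsNormalSubgroup N) (n : ℕ) :
    F.StronglyClosed (N.lowerCentralSeries n) := by
  have hN' := isNormalSubgroup_iff.1 hN
  refine stronglyClosed_iff.2 ⟨(N.lowerCentralSeries_le_self n).trans hN.1, fun A f hf hA x hx => ?_⟩
  obtain ⟨f', h₁, h₂, h₃⟩ := hN'.2 A f hf
  rw [← h₂ x hx]
  exact ((h₁.restrict le_sup_left).iso_of_card h₃ le_rfl).map_lowerCentralSeries (hA hx)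

section Quotient

open QuotientGroup

/-- A morphism on a subgroup not containing `K` induces nothing on the factor system.
`IsSaturated.extendsMod` replaces it by one on `AK` with the same values modulo `K`. -/
lemma stronglyClosed_comap [Fact p.Prime] (hG : IsPGroup p G) (hF : F.IsSaturated p) [K.Normal]
    (hK : F.StronglyClosed K) {D : Subgroup (G ⧸ K)} (hD : (F.factor K hK).StronglyClosed D) :
    F.StronglyClosed (D.comap (mk' K)) := by
  refine stronglyClosed_iff.2 ⟨comap_le_carrier hK hD.1, fun A f hf hA x hx => ?_⟩
  obtain ⟨f', h₁, h₂⟩ := hF.extendsMod hG hK hf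
  obtain ⟨k, h₃, h₄⟩ := exists_factor_mor hK le_sup_right h₁
  have hx' := le_sup_left (a := A) (b := K) hx
  have h₅ := hD.mem h₃ (x := (x : G ⧸ K)) ⟨x, hx', rfl⟩ (hA hx)
  rw [h₄ x hx', ← mk_eq_iff.2 (h₂ x hx)] at h₅
  exact h₅

/-- Otherwise the image of the intersection with `N` is a non-trivial strongly `D`-closed subgroup.
It is abelian, since commutators fall into the intersection with `M`, and `IsSimple.exists_prime`
applies. -/
lemma inf_le_of_commutator_le [Fact p.Prime] (hG : IsPGroup p G) [K.Normal]
    (hK : F.StronglyClosed K) {D : FusionSystem (G ⧸ K)} (hD : D.IsSubsystem (F.quotient K))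
    (hs : D.IsNonabelianSimple p) (hN : F.StronglyClosed N) (hNM : ⁅N, N⁆ ≤ M)
    (hM : D.carrier.comap (mk' K) ⊓ M ≤ K) : D.carrier.comap (mk' K) ⊓ N ≤ K := by
  by_contra hne
  refine hs.2 (hs.1.exists_prime (M := (D.carrier.comap (mk' K) ⊓ N).map (mk' K))
    (hG.to_quotient K) (stronglyClosed_iff.2 ⟨?_, ?_⟩) ?_ ?_)
  · rw [Subgroup.map_le_iff_le_comap]
    exact inf_le_left
  · intro A k hk hA a ha
    obtain ⟨f, hf, hfk⟩ := factor_mor hK (mor_of_isSubsystem (F := F.factor K hK) hD hk)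
    obtain ⟨x, ⟨-, hxN⟩, rfl⟩ := hA ha
    have h₁ := hfk x ha
    have h₂ := hk.mem ha
    change k (x : G ⧸ K) ∈ _ at h₂
    change k (x : G ⧸ K) ∈ _
    rw [h₁] at h₂ ⊢
    exact ⟨f x, ⟨h₂, hN.mem hf ha hxN⟩, rfl⟩
  · rw [Ne, Subgroup.map_eq_bot_iff, ker_mk']
    exact hne
  · rw [← Subgroup.map_commutator, Subgroup.map_eq_bot_iff, ker_mk']
    refine le_trans (le_inf ?_ ?_) hM
    · exact (Subgroup.commutator_mono inf_le_left inf_le_left).trans (Subgroup.commutator_le_self _)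
    · exact (Subgroup.commutator_mono inf_le_right inf_le_right).trans hNM

/-- The preimages of the lower central series of $O_p(\mathcal F/M)$ are strongly closed and lead
from `M` to a group containing `N` through abelian factors; `inf_le_of_commutator_le` climbs each of
them. -/
lemma inf_le_of_le_Op [Fact p.Prime] (hG : IsPGroup p G) (hF : F.IsSaturated p) [K.Normal]
    (hK : F.StronglyClosed K) {D : FusionSystem (G ⧸ K)} (hD : D.IsSubsystem (F.quotient K))
    (hs : D.IsNonabelianSimple p) [M.Normal] (hM : F.StronglyClosed M)
    (hN : N.map (mk' M) ≤ (F.quotient M).Op)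
    (hMK : D.carrier.comap (mk' K) ⊓ M ≤ K) : D.carrier.comap (mk' K) ⊓ N ≤ K := by
  set O := (F.factor M hM).Op
  let d : ℕ → Subgroup G := fun n => (O.lowerCentralSeries n).comap (mk' M)
  have hd : ∀ n, F.StronglyClosed (d n) := fun n =>
    stronglyClosed_comap hG hF hM (stronglyClosed_lowerCentralSeries isNormalSubgroup_Op n)
  have hstep : ∀ n, ⁅d n, d n⁆ ≤ d (n + 1) := fun n => by
    rw [← Subgroup.map_le_iff_le_comap, Subgroup.map_commutator, map_comap_mk]
    exact Subgroup.commutator_mono le_rfl (O.lowerCentralSeries_le_self n)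
  have : Group.IsNilpotent O := ((hG.to_quotient M).to_subgroup O).isNilpotent
  obtain ⟨m, hm⟩ := (Subgroup.isNilpotent_iff_lowerCentralSeries O).1 this
  have hdm : d m = M := by
    change (O.lowerCentralSeries m).comap (mk' M) = M
    rw [hm, MonoidHom.comap_bot, ker_mk']
  have key : D.carrier.comap (mk' K) ⊓ d 0 ≤ K := by
    refine Nat.decreasingInduction (motive := fun n _ => D.carrier.comap (mk' K) ⊓ d n ≤ K)
      (fun n _ ih => inf_le_of_commutator_le hG hK hD hs (hd n) (hstep n) ih) (hdm.symm ▸ hMK)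
      (Nat.zero_le m)
  exact (inf_le_inf_left _ (Subgroup.map_le_iff_le_comap.1 hN)).trans key

end Quotient

end FusionSystem

/-! ### Chains witnessing $p$-solubility -/

namespace PrefusionSystem

variable {G : Type u} [Group G] {F : PrefusionSystem G} {K N : Subgroup G}

/-- There is a chain `1 = P₀ ≤ P₁ ≤ ⋯ ≤ Pₙ = K` of strongly closed subgroups with
`Pᵢ₊₁/Pᵢ ≤ O_p(F/Pᵢ)`. -/
def HasChain (F : PrefusionSystem G) (K : Subgroup G) : Prop :=
  ∃ (n : ℕ) (c : Fin (n + 1) → Subgroup G) (_ : ∀ i, (c i).Normal),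
    c 0 = ⊥ ∧ c (Fin.last n) = K ∧ Monotone c ∧ (∀ i, F.StronglyClosed (c i)) ∧
    ∀ i : Fin n, (c i.succ).map (QuotientGroup.mk' (c i.castSucc)) ≤
      (F.quotient (c i.castSucc)).Op

lemma hasChain_bot (h : F.StronglyClosed ⊥) : F.HasChain ⊥ :=
  ⟨0, fun _ => ⊥, fun _ => inferInstance, rfl, rfl, monotone_const, fun _ => h, fun i => i.elim0⟩

lemma HasChain.step (h : F.HasChain K) [K.Normal] [N.Normal] (hKN : K ≤ N)
    (hN : F.StronglyClosed N) (hle : N.map (QuotientGroup.mk' K) ≤ (F.quotient K).Op) :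
    F.HasChain N := by
  -- The factor system depends on a proof of normality; bundling that proof into the relation lets
  -- equal terms of the chains be exchanged.
  let R (K N : Subgroup G) : Prop :=
    ∃ _ : K.Normal, N.map (QuotientGroup.mk' K) ≤ (F.quotient K).Op
  have hR : R K N := ⟨inferInstance, hle⟩
  obtain ⟨n, c, hc, h₀, h₁, hm, hs, ho⟩ := h
  have ho' : ∀ i : Fin n, R (c i.castSucc) (c i.succ) := fun i => ⟨hc _, ho i⟩
  let d : Fin (n + 1 + 1) → Subgroup G := Fin.snoc (α := fun _ => Subgroup G) c N
  have hd : ∀ i : Fin (n + 1), d i.castSucc = c i := fun i => Fin.snoc_castSucc _ _ _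
  have hd' : d (Fin.last (n + 1)) = N := Fin.snoc_last _ _
  have hall : ∀ {q : Subgroup G → Prop}, (∀ i, q (c i)) → q N → ∀ i, q (d i) := by
    intro q hq hqN i
    induction i using Fin.lastCases with
    | last => rwa [hd']
    | cast i => rw [hd]; exact hq i
  have hstep : ∀ {q : Subgroup G → Subgroup G → Prop}, (∀ i : Fin n, q (c i.castSucc) (c i.succ)) →
      q K N → ∀ i : Fin (n + 1), q (d i.castSucc) (d i.succ) := by
    intro q hq hqN i
    induction i using Fin.lastCases with
    | last => rwa [Fin.succ_last, hd', hd, h₁]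
    | cast i => rw [Fin.succ_castSucc, hd, hd]; exact hq i
  refine ⟨n + 1, d, hall hc inferInstance, ?_, hd', ?_, hall hs hN, fun i => ?_⟩
  · rw [← Fin.castSucc_zero, hd, h₀]
  · exact Fin.monotone_iff_le_succ.2 (hstep (fun i => hm (Fin.castSucc_le_succ i)) hKN)
  · obtain ⟨_, h⟩ := hstep ho' hR i
    exact h

end PrefusionSystem

/-! ### The criterion for $p$-solubility -/

namespace FusionSystem

variable {G : Type u} [Group G] [Finite G] {F : FusionSystem G} {p : ℕ} [Fact p.Prime]

theorem not_exists_isNonabelianSimple (hG : IsPGroup p G) (hF : F.IsSaturated p)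
    (hs : F.IsPSoluble) {R : Subgroup G} [R.Normal] (hR : F.StronglyClosed R)
    {E : FusionSystem (G ⧸ R)} (hE : E.IsSubsystem (F.quotient R)) :
    ¬ E.IsNonabelianSimple p := by
  intro h
  obtain ⟨n, c, hc, h₀, h₁, -, hcl, hstep⟩ := hs
  have key : ∀ i, E.carrier.comap (QuotientGroup.mk' R) ⊓ c i ≤ R := fun i => by
    induction i using Fin.induction with
    | zero => simp [h₀]
    | succ i ih => exact inf_le_of_le_Op hG hF hR hE h (hcl _) (hstep i) ih
  have h₂ := key (Fin.last n)
  rw [h₁, inf_top_eq] at h₂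
  refine h.1.2.1 ?_
  rw [← map_comap_mk E.carrier, Subgroup.map_eq_bot_iff, QuotientGroup.ker_mk']
  exact h₂

theorem exists_isNonabelianSimple (hG : IsPGroup p G) (hFc : F.carrier = ⊤) (hF : F.IsSaturated p)
    (hs : ¬ F.IsPSoluble) : ∃ (R : Subgroup G) (_ : R.Normal), F.StronglyClosed R ∧
      ∃ E : FusionSystem (G ⧸ R), E.IsSubsystem (F.quotient R) ∧ E.IsNonabelianSimple p := by
  -- By maximality $O_p(\mathcal F/R)=1$, since otherwise its preimage would prolong the chain.
  obtain ⟨R, ⟨hRF, hRc⟩, hRm⟩ :=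
    (Set.toFinite {R | F.StronglyClosed R ∧ F.HasChain R}).exists_maximal
    ⟨⊥, stronglyClosed_bot, PrefusionSystem.hasChain_bot stronglyClosed_bot⟩
  have hRn := normal_of_stronglyClosed hFc hRF
  have hR1 : R ≠ ⊤ := fun e => hs (by subst e; exact hRc)
  have hF' := hF.factor hG hRF
  have hc : (F.factor R hRF).carrier ≠ ⊥ := by
    change F.carrier.map _ ≠ ⊥
    rw [Ne, Subgroup.map_eq_bot_iff, QuotientGroup.ker_mk', hFc, top_le_iff]
    exact hR1
  obtain ⟨E, hE⟩ := exists_isMinimalSubnormalIn (p := p) hc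
  have hsub : ∀ {D : FusionSystem (G ⧸ R)}, D.IsSubnormalIn p (F.factor R hRF) →
      D.IsSubsystem (F.quotient R) := fun {D} h => by
    induction h using Relation.ReflTransGen.head_induction_on with
    | refl => exact ⟨le_rfl, fun _ _ => le_rfl⟩
    | head h _ ih => exact ⟨h.1.1.1.trans ih.1, fun A B => (h.1.1.2 A B).trans (ih.2 A B)⟩
  refine ⟨R, hRn, hRF, E, hsub hE.1, hE.isSimple hF', ?_⟩
  rintro ⟨Q, hQ, rfl⟩
  -- The argument of (a), applied in $\mathcal F/R$: a subnormal $\mathcal F_Q(Q)$ forces $Q\le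
  -- O_p(\mathcal F/R)$.
  have hQO := (le_Op_ofSubgroup Q).trans (hE.1.Op_le (hG.to_quotient R) hF')
  set O := (F.factor R hRF).Op
  have hN := stronglyClosed_comap hG hF hRF
    (stronglyClosed_of_isNormalSubgroup (isNormalSubgroup_Op (F := F.factor R hRF)))
  have := normal_of_stronglyClosed hFc hN
  have hRN := le_comap_mk (K := R) O
  have h₁ := hRm ⟨hN, hRc.step hRN hN (map_comap_mk O).le⟩ hRN
  have hO : O = ⊥ := by
    rw [← map_comap_mk O, Subgroup.map_eq_bot_iff, QuotientGroup.ker_mk']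
    exact h₁
  have hQ1 : Q = ⊥ := le_bot_iff.1 (hQO.trans hO.le)
  rw [hQ1, Subgroup.card_bot] at hQ
  exact Nat.not_prime_one hQ

end FusionSystem

end Fusion

theorem mainTheorem11 {p : ℕ} [Fact p.Prime] {P : Type u} [Group P] [Finite P]
    (hP : IsPGroup p P) (F : Fusion.FusionSystem P) (hFP : F.carrier = ⊤)
    (hF : F.IsSaturated p) :
    (∀ (E : Fusion.FusionSystem P) (Q : Subgroup P), E.IsMinimalSubnormalIn p F →
      (Nat.card Q).Prime → E = Fusion.FusionSystem.ofSubgroup Q → Q ≤ F.Op) ∧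
    (¬ F.IsPSoluble ↔
      ∃ (R : Subgroup P) (_ : R.Normal), F.StronglyClosed R ∧
        ∃ E : Fusion.FusionSystem (P ⧸ R),
          E.toPrefusionSystem.IsSubsystem (F.quotient R) ∧ E.IsNonabelianSimple p) := by
  refine ⟨?_, fun h => Fusion.FusionSystem.exists_isNonabelianSimple hP hFP hF h, ?_⟩
  · rintro E Q hE - rfl
    exact (Fusion.FusionSystem.le_Op_ofSubgroup Q).trans (hE.1.Op_le hP hF)
  · rintro ⟨R, _, hR, E, hE, hs⟩ h
    exact Fusion.FusionSystem.not_exists_isNonabelianSimple hP hF h hR hE hs
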